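/- Let $(X_N)_{N}$ be a self-adjoint random matrix ensemble, i.e. for each $N$, $X_N$ is a random $N\times N$ Hermitian matrix defined on some probability space. For a function $f:\mathbb R\to\mathbb C$ write $\mathrm{Tr}(f(X_N))=\sum_k f(\lambda_k)$, where $\lambda_1,\dots,\lambda_N$ are the eigenvalues of $X_N$, and for complex random variables write $\mathrm{Cov}(Y,Z)=\mathbb E(YZ)-\mathbb E(Y)\mathbb E(Z)$ and $\mathrm{Var}(Y)=\mathbb E|Y-\mathbb E Y|^2$. Let $M,K>0$ and assume: * **A0.** For all $m,n\in\mathbb N$ the variables $\mathrm{Tr}(X_N^n)$ are square integrable and the limits $\alpha_n=\lim_{N}\frac1N\mathbb E(\mathrm{Tr}(X_N^n))$ and $\alpha_{m,n}=\lim_{N}\mathrm{Cov}(\mathrm{Tr}(X_N^m),\mathrm{Tr}(X_N^n))$ exist. * **A1.** $\lim_{N\to\infty}N^8\,\mathbb P(\|X_N\|>M)=0$, where $\|\cdot\|$ is the operator norm. * **A2.** $\mathrm{Var}(\mathrm{Tr}(f(X_N)))\le K\|f'\|_\infty^2$ for all $f\in C^1(\mathbb R)$ (complex valued) and all $N$.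 Let $\mathcal S$ be the set of polynomially bounded $f\in C^1(\mathbb R)$, let $C^1([-M,M])$ be the space of restrictions $f|_M$ to $[-M,M]$ of functions $f\in C^1(\mathbb R)$, and let $\|h\|_M=\sup_{|x|\le M}|h(x)|$. Then: 1. There is exactly one bilinear map $\rho:C^1([-M,M])\times C^1([-M,M])\to\mathbb C$ with $\rho(x^m,x^n)=\alpha_{m,n}$ for all $m,n\ge 0$ and $|\rho(f,g)|\le K\|f'\|_M\|g'\|_M$ for all $f,g$. For all $f,g\in\mathcal S$, $$\lim_{N\to\infty}\mathrm{Cov}(\mathrm{Tr}(f(X_N)),\mathrm{Tr}(g(X_N)))=\rho(f|_M,g|_M).$$ 2. There is an analytic function $G_2$ on $(\mathbb C\setminus[-M,M])^2$ such that $G_2(z,w)=\sum_{m,n\ge1}\dfrac{\alpha_{m,n}}{z^{m+1}w^{n+1}}$ for all $|z|,|w|>M$. 3. Let $f,g\in\mathcal S$, and suppose that $f|_M$ and $g|_M$ extend to analytic functions, again denoted by $f$ and $g$, on a domain (open connected set) $\Omega\subset\mathbb C$ with $[-M,M]\subset\Omega$. Then, for $\rho$ and $G_2$ as in 1 and 2,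 $$\rho(f|_M,g|_M)=\frac1{(2\pi i)^2}\oint_{\mathcal C}\oint_{\mathcal C}f(z)\,g(w)\,G_2(z,w)\,dz\,dw$$ for every positively oriented, piecewise $C^1$, simple closed contour $\mathcal C$ that encloses $[-M,M]$ and is contained in $\Omega$ together with the region it encloses. -/

import Mathlib

open MeasureTheory Filter Topology

universe u

/-- A self-adjoint random matrix ensemble `(X_N)_N`: for each `N`, a random `N × N` Hermitian complex
matrix `X_N`, defined on its own probability space. -/
structure SelfAdjointEnsemble where
  /-- the sample spaces -/
  Ω : ℕ → Type u
  /-- the σ-algebras -/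
  mΩ : ∀ N, MeasurableSpace (Ω N)
  /-- the probability measures -/
  P : ∀ N, Measure (Ω N)
  isProb : ∀ N, IsProbabilityMeasure (P N)
  /-- the matrices -/
  X : ∀ N, Ω N → Matrix (Fin N) (Fin N) ℂ
  measurable_entry : ∀ N i j, Measurable fun ω => X N ω i j
  hermitian : ∀ N ω, (X N ω).IsHermitian

namespace SelfAdjointEnsemble

instance instMeasurableSpaceSample (E : SelfAdjointEnsemble.{u}) (N : ℕ) :
    MeasurableSpace (E.Ω N) := E.mΩ N

noncomputable section

/-- `Tr (X_N ^ n)` -/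
def trPow (E : SelfAdjointEnsemble.{u}) (n N : ℕ) (ω : E.Ω N) : ℂ :=
  (E.X N ω ^ n).trace

/-- The linear statistic `Tr (f (X_N)) = ∑ k, f (λ_k)`, the sum over the eigenvalues of `X_N`
with multiplicity. -/
def trFun (E : SelfAdjointEnsemble.{u}) (f : ℝ → ℂ) (N : ℕ) (ω : E.Ω N) : ℂ :=
  ∑ k, f ((E.hermitian N ω).eigenvalues k)

/-- The operator norm of `X_N`, acting on `ℂ ^ N` with its Euclidean norm. -/
def opNorm (E : SelfAdjointEnsemble.{u}) (N : ℕ) (ω : E.Ω N) : ℝ :=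
  ‖Matrix.toEuclideanCLM (n := Fin N) (𝕜 := ℂ) (E.X N ω)‖

/-- The bilinear covariance `Cov (Y, Z) = 𝔼 (Y Z) - 𝔼 (Y) 𝔼 (Z)` of complex random variables
on the `N`-th probability space. -/
def cov (E : SelfAdjointEnsemble.{u}) (N : ℕ) (Y Z : E.Ω N → ℂ) : ℂ :=
  (∫ ω, Y ω * Z ω ∂E.P N) - (∫ ω, Y ω ∂E.P N) * ∫ ω, Z ω ∂E.P N

/-- The variance `𝔼 |Y - 𝔼 Y| ^ 2` of a complex random variable, as an extended nonnegative real. -/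
def variance (E : SelfAdjointEnsemble.{u}) (N : ℕ) (Y : E.Ω N → ℂ) : ENNReal :=
  ∫⁻ ω, ‖Y ω - ∫ ω', Y ω' ∂E.P N‖ₑ ^ 2 ∂E.P N

/-- The second-order moment `α_{m,n} = lim_N Cov (Tr (X_N ^ m), Tr (X_N ^ n))`. -/
def secondMoment (E : SelfAdjointEnsemble.{u}) (m n : ℕ) : ℂ :=
  limUnder atTop fun N => E.cov N (E.trPow m N) (E.trPow n N)

/-- A0: the first- and second-order moments exist. The square integrability says that the expectations
and covariances whose limits are taken are meaningful. -/
structure A0 (E : SelfAdjointEnsemble.{u}) : Prop where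
  memLp : ∀ n N, MemLp (E.trPow n N) 2 (E.P N)
  first : ∀ n, ∃ a : ℂ,
    Tendsto (fun N : ℕ => (1 / (N : ℂ)) * ∫ ω, E.trPow n N ω ∂E.P N) atTop (𝓝 a)
  second : ∀ m n, ∃ a : ℂ,
    Tendsto (fun N : ℕ => E.cov N (E.trPow m N) (E.trPow n N)) atTop (𝓝 a)

/-- A1 with the constant `M`: `lim_N N ^ 8 ℙ (‖X_N‖ > M) = 0`. -/
def A1 (E : SelfAdjointEnsemble.{u}) (M : ℝ) : Prop :=
  Tendsto (fun N : ℕ => (N : ℝ) ^ 8 * (E.P N).real {ω | M < E.opNorm N ω}) atTop (𝓝 0)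

/-- A2 with the constant `K`: `Var (Tr (f (X_N))) ≤ K ‖f'‖_∞ ^ 2` for all `f ∈ C¹(ℝ)` and all `N`;
the inequality is trivially true when `f'` is unbounded. -/
def A2 (E : SelfAdjointEnsemble.{u}) (K : ℝ) : Prop :=
  ∀ f : ℝ → ℂ, ContDiff ℝ 1 f → ∀ N : ℕ,
    E.variance N (E.trFun f N) ≤ ENNReal.ofReal K * (⨆ x : ℝ, ‖deriv f x‖ₑ) ^ 2

end

end SelfAdjointEnsemble

/-- The class `𝒮` of polynomially bounded functions in `C¹(ℝ)`. -/
def IsSmoothTest (f : ℝ → ℂ) : Prop :=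
  ContDiff ℝ 1 f ∧ ∃ (C : ℝ) (k : ℕ), ∀ x : ℝ, ‖f x‖ ≤ C * (1 + |x|) ^ k

/-- `C¹([-M, M])`, the space of restrictions to `[-M, M]` of functions in `C¹(ℝ)`. -/
def C1On (M : ℝ) : Submodule ℂ (Set.Icc (-M) M → ℂ) where
  carrier := {h | ∃ f : ℝ → ℂ, ContDiff ℝ 1 f ∧ ∀ x, h x = f x}
  add_mem' := by
    rintro a b ⟨f, hf, hfa⟩ ⟨g, hg, hgb⟩
    exact ⟨fun x => f x + g x, hf.add hg, fun x => by simp [hfa, hgb]⟩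
  zero_mem' := ⟨fun _ => 0, contDiff_const, fun _ => rfl⟩
  smul_mem' := by
    rintro c a ⟨f, hf, hfa⟩
    exact ⟨fun x => c * f x, contDiff_const.mul hf, fun x => by simp [hfa]⟩

/-- The restriction `f|_M` of `f ∈ C¹(ℝ)` to `[-M, M]`. -/
def restrictC1 (M : ℝ) (f : ℝ → ℂ) (hf : ContDiff ℝ 1 f) : C1On M :=
  ⟨fun x => f x, f, hf, fun _ => rfl⟩

noncomputable section

/-- `‖h‖_M = sup {|h x| : |x| ≤ M}` -/
def supNormOn (M : ℝ) (h : ℝ → ℂ) : ℝ :=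
  ⨆ x : Set.Icc (-M) M, ‖h x‖

/-- `ρ` is a bilinear extension to `C¹([-M, M])` of `(x ^ m, x ^ n) ↦ α_{m,n}` that satisfies
`|ρ(f, g)| ≤ K ‖f'‖_M ‖g'‖_M`. -/
structure IsCovarianceExtension (E : SelfAdjointEnsemble.{u}) (M K : ℝ)
    (ρ : C1On M →ₗ[ℂ] C1On M →ₗ[ℂ] ℂ) : Prop where
  moments : ∀ (m n : ℕ) (hm : ContDiff ℝ 1 fun x : ℝ => (x : ℂ) ^ m)
    (hn : ContDiff ℝ 1 fun x : ℝ => (x : ℂ) ^ n),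
    ρ (restrictC1 M _ hm) (restrictC1 M _ hn) = E.secondMoment m n
  bound : ∀ (f g : ℝ → ℂ) (hf : ContDiff ℝ 1 f) (hg : ContDiff ℝ 1 g),
    ‖ρ (restrictC1 M f hf) (restrictC1 M g hg)‖ ≤
      K * supNormOn M (deriv f) * supNormOn M (deriv g)

/-- The interval `[-M, M]` as a subset of the complex plane. -/
def realSegment (M : ℝ) : Set ℂ :=
  (fun x : ℝ => (x : ℂ)) '' Set.Icc (-M) M

/-- `G` is the second-order Cauchy transform: it is (jointly) analytic on `(ℂ ∖ [-M, M]) ^ 2`, and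
`G (z, w) = ∑_{m, n ≥ 1} α_{m,n} / (z ^ (m + 1) w ^ (n + 1))` for `|z|, |w| > M`.
The summation index `p` stands for `(m, n) = (p.1 + 1, p.2 + 1)`. -/
structure IsSecondOrderCauchyTransform (E : SelfAdjointEnsemble.{u}) (M : ℝ)
    (G : ℂ × ℂ → ℂ) : Prop where
  analytic : AnalyticOnNhd ℂ G ((realSegment M)ᶜ ×ˢ (realSegment M)ᶜ)
  series : ∀ z w : ℂ, M < ‖z‖ → M < ‖w‖ →
    HasSum (fun p : ℕ × ℕ =>
      E.secondMoment (p.1 + 1) (p.2 + 1) / (z ^ (p.1 + 2) * w ^ (p.2 + 2))) (G (z, w))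

/-- The contour integral `∫_γ F(z) dz` of a piecewise `C¹` curve `γ : [0, 1] → ℂ`. -/
def contourIntegral (γ : ℝ → ℂ) (F : ℂ → ℂ) : ℂ :=
  ∫ t in (0 : ℝ)..1, F (γ t) * deriv γ t

/-- `γ : [0, 1] → ℂ` is a simple closed contour: a continuous, piecewise `C¹` closed curve (with
finitely many breakpoints `s`) without self-intersections. -/
structure IsSimpleClosedContour (γ : ℝ → ℂ) : Prop where
  continuousOn : ContinuousOn γ (Set.Icc 0 1)
  piecewise : ∃ s : Finset ℝ, ∀ a b : ℝ, 0 ≤ a → a < b → b ≤ 1 →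
    Disjoint (Set.Ioo a b) (s : Set ℝ) → ContDiffOn ℝ 1 γ (Set.Icc a b)
  closed : γ 0 = γ 1
  simple : Set.InjOn γ (Set.Ico 0 1)

/-- The trace of the curve. -/
def contourImage (γ : ℝ → ℂ) : Set ℂ :=
  γ '' Set.Icc 0 1

/-- The region enclosed by the curve: the points whose connected component in the complement of the
curve is bounded. -/
def contourInterior (γ : ℝ → ℂ) : Set ℂ :=
  {z | z ∈ (contourImage γ)ᶜ ∧ Bornology.IsBounded (connectedComponentIn (contourImage γ)ᶜ z)}

/-- Positive orientation: the curve winds once, counterclockwise, around every point it encloses. -/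
def IsPositivelyOriented (γ : ℝ → ℂ) : Prop :=
  ∀ z ∈ contourInterior γ,
    (2 * (Real.pi : ℂ) * Complex.I)⁻¹ * contourIntegral γ (fun ζ => (ζ - z)⁻¹) = 1

/-- `F` is an analytic extension of `f|_M` to the set `U`. -/
def IsAnalyticExtension (M : ℝ) (f : ℝ → ℂ) (U : Set ℂ) (F : ℂ → ℂ) : Prop :=
  AnalyticOnNhd ℂ F U ∧ ∀ x ∈ Set.Icc (-M) M, F (x : ℂ) = f x

end

/-! Covariance ignores constants, so the covariance of two linear statistics should be a bilinear
form in the derivatives of the test functions. For `v` in `C([-M, M])`, extend `v` constantly on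
both sides and let `primitive` integrate it. The derivative on the whole line is then bounded by
`‖v‖`, so A2 and Cauchy–Schwarz bound the form `covForm` by `K ‖v‖ ‖w‖` uniformly in `N`. A0 gives
convergence on monomials, and Weierstrass density with the uniform bound gives convergence
everywhere, to a bounded form `B` (`exists_limit_covForm`).

A general test function is `f = f 0 + primitive + g` with `g` zero on `[-M, M]`. The statistic of
`g` tends to zero in `L²` by A1 and the bounded normalized moments
(`tendsto_integral_norm_sq_trFun`). Hence covariances converge to `B (f', g')`, which defines `ρ`.
Conversely, the derivative bound makes every admissible `ρ` vanish on constants, so it factors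
through derivatives and is determined by its values on monomials.

Since `∑ (m + 1) x ^ m / z ^ (m + 2) = (z - x) ^ (-2)`, the Cauchy transform is `B` applied to `(z -
x) ^ (-2)` and `(w - x) ^ (-2)`. It is the only one, because the complement of the segment is
connected. Cauchy's formula for the derivative, read as an identity in `C([-M, M])`
(`contourIntegral_smul_resolventSq`), passes through `B` in each variable and gives the double
integral. For general contours the formula comes from Dixon's proof of Cauchy's theorem
(`contourIntegral_dslope_eq_zero`). -/

/-! ### Integration along piecewise `C¹` closed contours -/

namespace IsSimpleClosedContour

variable {γ : ℝ → ℂ}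

lemma exists_finset_differentiableAt (hγ : IsSimpleClosedContour γ) :
    ∃ s : Finset ℝ, ∀ t ∈ Set.Ioo (0 : ℝ) 1 \ s, DifferentiableAt ℝ γ t := by
  obtain ⟨s, hs⟩ := hγ.piecewise
  refine ⟨s, fun t ht => ?_⟩
  have hopen : IsOpen (Set.Ioo (0 : ℝ) 1 \ s) := isOpen_Ioo.sdiff s.finite_toSet.isClosed
  obtain ⟨ε, hε, hsub⟩ := Metric.isOpen_iff.1 hopen t ht
  rw [Real.ball_eq_Ioo] at hsub
  have hIcc : ∀ x ∈ Set.Icc (t - ε / 2) (t + ε / 2), x ∈ Set.Ioo (0 : ℝ) 1 \ s := fun x hx =>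
    hsub ⟨by linarith [hx.1], by linarith [hx.2]⟩
  have h := hs (t - ε / 2) (t + ε / 2) (hIcc _ ⟨le_rfl, by linarith⟩).1.1.le (by linarith)
    (hIcc _ ⟨by linarith, le_rfl⟩).1.2.le
    (Set.disjoint_left.2 fun x hx => (hIcc x ⟨hx.1.le, hx.2.le⟩).2)
  exact (h.contDiffAt (Icc_mem_nhds (by linarith) (by linarith))).differentiableAt one_ne_zero

lemma integrableOn_deriv_Ioo {a b : ℝ} (hab : a < b) (h : ContDiffOn ℝ 1 γ (Set.Icc a b)) :
    IntegrableOn (deriv γ) (Set.Ioo a b) := by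
  have h1 : IntegrableOn (derivWithin γ (Set.Icc a b)) (Set.Ioo a b) :=
    ((h.continuousOn_derivWithin (uniqueDiffOn_Icc hab) le_rfl).integrableOn_compact
      isCompact_Icc).mono_set Set.Ioo_subset_Icc_self
  exact h1.congr_fun (fun x hx => derivWithin_of_mem_nhds (Icc_mem_nhds hx.1 hx.2))
    measurableSet_Ioo

/-- Every parameter has one-sided neighbourhoods free of other breakpoints. On each of them the
derivative extends continuously to the closed interval, hence is integrable, and compactness of `[0,
1]` makes local integrability global. -/
lemma integrableOn_deriv (hγ : IsSimpleClosedContour γ) :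
    IntegrableOn (deriv γ) (Set.Icc 0 1) := by
  obtain ⟨s, hs⟩ := hγ.piecewise
  have hR : ∀ c ∈ Set.Icc (0 : ℝ) 1, ∃ b > c,
      IntegrableOn (deriv γ) (Set.Ioo c b ∩ Set.Icc 0 1) := fun c hc => by
    rcases hc.2.lt_or_eq with h1 | rfl
    · have hev : ∀ᶠ x in 𝓝[>] c, x ∉ ((s : Set ℝ) \ {c}) :=
        nhdsWithin_le_nhds <| ((s.finite_toSet.sdiff).isClosed.isOpen_compl.mem_nhds (by simp))
      obtain ⟨b, hb, hbs⟩ := (mem_nhdsGT_iff_exists_Ioo_subset' h1).1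
        (inter_mem hev (Ioo_mem_nhdsGT h1))
      refine ⟨b, hb, ?_⟩
      have hcb : c < b := hb
      have hb1 : b ≤ 1 := by
        by_contra! h
        exact absurd (hbs (show max c 1 ∈ Set.Ioo c b by simp [h1, h, hcb])).2.2
          (not_lt.2 (le_max_right _ _))
      refine (integrableOn_deriv_Ioo hb (hs c b hc.1 hb hb1 ?_)).mono_set Set.inter_subset_left
      exact Set.disjoint_left.2 fun x hx hxs => (hbs hx).1 ⟨hxs, hx.1.ne'⟩
    · exact ⟨2, by norm_num, by
        rw [show Set.Ioo (1 : ℝ) 2 ∩ Set.Icc 0 1 = ∅ from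
          Set.eq_empty_of_forall_notMem fun x hx => absurd hx.1.1 (not_lt.2 hx.2.2)]
        exact integrableOn_empty⟩
  have hL : ∀ c ∈ Set.Icc (0 : ℝ) 1, ∃ a < c,
      IntegrableOn (deriv γ) (Set.Ioo a c ∩ Set.Icc 0 1) := fun c hc => by
    rcases hc.1.lt_or_eq with h1 | rfl
    · have hev : ∀ᶠ x in 𝓝[<] c, x ∉ ((s : Set ℝ) \ {c}) :=
        nhdsWithin_le_nhds <| ((s.finite_toSet.sdiff).isClosed.isOpen_compl.mem_nhds (by simp))
      obtain ⟨a, ha, hbs⟩ := (mem_nhdsLT_iff_exists_Ioo_subset' h1).1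
        (inter_mem hev (Ioo_mem_nhdsLT h1))
      refine ⟨a, ha, ?_⟩
      have hcb : a < c := ha
      have hb1 : 0 ≤ a := by
        by_contra! h
        exact absurd (hbs (show min c 0 ∈ Set.Ioo a c by simp [h1, h, hcb])).2.1
          (not_lt.2 (min_le_right _ _))
      refine (integrableOn_deriv_Ioo ha (hs a c hb1 ha hc.2 ?_)).mono_set Set.inter_subset_left
      exact Set.disjoint_left.2 fun x hx hxs => (hbs hx).1 ⟨hxs, hx.2.ne⟩
    · exact ⟨-1, by norm_num, by
        rw [show Set.Ioo (-1 : ℝ) 0 ∩ Set.Icc 0 1 = ∅ from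
          Set.eq_empty_of_forall_notMem fun x hx => absurd hx.1.2 (not_lt.2 hx.2.1)]
        exact integrableOn_empty⟩
  refine LocallyIntegrableOn.integrableOn_isCompact (fun c hc => ?_) isCompact_Icc
  obtain ⟨b, hb, hbi⟩ := hR c hc
  obtain ⟨a, ha, hai⟩ := hL c hc
  -- At a breakpoint `deriv γ` may be a default value; a single point is null.
  have hsing : IntegrableOn (deriv γ) {c} := 
    integrableOn_singleton (by simp) (by simp)
  refine ⟨Set.Icc 0 1 ∩ Set.Ioo a b, inter_mem_nhdsWithin _ (Ioo_mem_nhds ha hb), ?_⟩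
  refine ((hai.union hbi).union hsing).mono_set fun x hx => ?_
  rcases lt_trichotomy x c with h | h | h
  · exact .inl (.inl ⟨⟨hx.2.1, h⟩, hx.1⟩)
  · exact .inr h
  · exact .inl (.inr ⟨⟨h, hx.2.2⟩, hx.1⟩)

lemma intervalIntegrable_deriv (hγ : IsSimpleClosedContour γ) :
    IntervalIntegrable (deriv γ) volume 0 1 :=
  (intervalIntegrable_iff_integrableOn_Icc_of_le zero_le_one).2 hγ.integrableOn_deriv

lemma isCompact_image (hγ : IsSimpleClosedContour γ) : IsCompact (contourImage γ) :=
  isCompact_Icc.image_of_continuousOn hγ.continuousOn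

lemma continuousOn_comp {X : Type*} [TopologicalSpace X] {F : ℂ → X}
    (hγ : IsSimpleClosedContour γ) (hF : ContinuousOn F (contourImage γ)) :
    ContinuousOn (fun t => F (γ t)) (Set.uIcc 0 1) := by
  rw [Set.uIcc_of_le zero_le_one]
  exact hF.comp hγ.continuousOn (Set.mapsTo_image _ _)

lemma intervalIntegrable (hγ : IsSimpleClosedContour γ) {F : ℂ → ℂ}
    (hF : ContinuousOn F (contourImage γ)) :
    IntervalIntegrable (fun t => F (γ t) * deriv γ t) volume 0 1 :=
  hγ.intervalIntegrable_deriv.continuousOn_mul (hγ.continuousOn_comp hF)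

lemma norm_contourIntegral_le (hγ : IsSimpleClosedContour γ) {F : ℂ → ℂ} {C : ℝ}
    (hC : ∀ w ∈ contourImage γ, ‖F w‖ ≤ C) :
    ‖contourIntegral γ F‖ ≤ C * ∫ t in (0 : ℝ)..1, ‖deriv γ t‖ := by
  rw [← intervalIntegral.integral_const_mul]
  refine intervalIntegral.norm_integral_le_of_norm_le zero_le_one (.of_forall fun t ht => ?_)
    (hγ.intervalIntegrable_deriv.norm.const_mul C)
  rw [norm_mul]
  exact mul_le_mul_of_nonneg_right (hC _ (Set.mem_image_of_mem γ ⟨ht.1.le, ht.2⟩)) (norm_nonneg _)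

/-- The integral of a derivative around a closed contour vanishes. -/
lemma contourIntegral_eq_zero_of_hasDerivAt (hγ : IsSimpleClosedContour γ) {P p : ℂ → ℂ}
    (hP : ∀ w ∈ contourImage γ, HasDerivAt P (p w) w) (hp : ContinuousOn p (contourImage γ)) :
    contourIntegral γ p = 0 := by
  obtain ⟨s, hs⟩ := hγ.exists_finset_differentiableAt
  have hPc : ContinuousOn P (contourImage γ) := fun w hw =>
    (hP w hw).continuousAt.continuousWithinAt
  have h := integral_eq_of_hasDerivAt_off_countable (fun t => P (γ t))
    (fun t => p (γ t) * deriv γ t) s.countable_toSet (hγ.continuousOn_comp hPc) (fun t ht => by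
      rw [min_eq_left zero_le_one, max_eq_right zero_le_one] at ht
      exact (hP _ (Set.mem_image_of_mem γ ⟨ht.1.1.le, ht.1.2.le⟩)).comp t (hs t ht).hasDerivAt)
    (hγ.intervalIntegrable hp)
  rw [contourIntegral, h, hγ.closed, sub_self]

/-- Differentiation under a contour integral of a holomorphic family. -/
lemma hasDerivAt_contourIntegral (hγ : IsSimpleClosedContour γ) {U : Set ℂ} (hU : IsOpen U)
    {Φ : ℂ → ℂ → ℂ} (hΦ : ContinuousOn (Function.uncurry Φ) (U ×ˢ contourImage γ))
    (hd : ∀ w ∈ contourImage γ, DifferentiableOn ℂ (fun z => Φ z w) U) {z₀ : ℂ} (hz₀ : z₀ ∈ U) :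
    HasDerivAt (fun z => contourIntegral γ (Φ z))
      (contourIntegral γ fun w => deriv (fun z => Φ z w) z₀) z₀ := by
  obtain ⟨R, hR, hRU⟩ := Metric.nhds_basis_closedBall.mem_iff.1 (hU.mem_nhds hz₀)
  have hcpt : IsCompact (Metric.closedBall z₀ R ×ˢ contourImage γ) :=
    (isCompact_closedBall _ _).prod hγ.isCompact_image
  obtain ⟨C, hC⟩ := hcpt.exists_bound_of_continuousOn
    (hΦ.mono (Set.prod_mono hRU subset_rfl))
  have hcont : ∀ z ∈ U, ContinuousOn (Φ z) (contourImage γ) := fun z hz =>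
    hΦ.comp (by fun_prop : ContinuousOn (fun w => (z, w)) _) fun w hw => ⟨hz, hw⟩
  have hmem : ∀ t ∈ Set.uIoc (0 : ℝ) 1, γ t ∈ contourImage γ := fun t ht => by
    rw [Set.uIoc_of_le zero_le_one] at ht
    exact Set.mem_image_of_mem γ ⟨ht.1.le, ht.2⟩
  have hmeas : ∀ z ∈ U, AEStronglyMeasurable (fun t => Φ z (γ t) * deriv γ t)
      (volume.restrict (Set.uIoc 0 1)) := fun z hz =>
    (intervalIntegrable_iff.1 (hγ.intervalIntegrable (hcont z hz))).aestronglyMeasurable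
  have hderiv : ∀ z ∈ U, ∀ w ∈ contourImage γ,
      HasDerivAt (fun z => Φ z w) (deriv (fun z => Φ z w) z) z := fun z hz w hw =>
    ((hd w hw).differentiableAt (hU.mem_nhds hz)).hasDerivAt
  refine (intervalIntegral.hasDerivAt_integral_of_dominated_loc_of_deriv_le (μ := volume)
    (F := fun z t => Φ z (γ t) * deriv γ t)
    (F' := fun z t => deriv (fun z => Φ z (γ t)) z * deriv γ t)
    (bound := fun t => C / (R / 2) * ‖deriv γ t‖)
    (Metric.ball_mem_nhds z₀ (half_pos hR)) ?_ (hγ.intervalIntegrable (hcont z₀ hz₀)) ?_ ?_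
    (hγ.intervalIntegrable_deriv.norm.const_mul _) ?_).2
  · filter_upwards [hU.mem_nhds hz₀] with z hz using hmeas z hz
  -- Measurability of the derivative integrand: it is the pointwise limit of difference quotients at
  -- `z₀ + 1 / (n + 1)`, with the index shifted so that these points lie in `U`.
  · obtain ⟨N, hN⟩ : ∃ N : ℕ, ∀ n ≥ N, z₀ + 1 / ((n : ℂ) + 1) ∈ U := by
      have : Tendsto (fun n : ℕ => z₀ + 1 / ((n : ℂ) + 1)) atTop (𝓝 (z₀ + 0)) :=
        tendsto_const_nhds.add tendsto_one_div_add_atTop_nhds_zero_nat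
      rw [add_zero] at this
      exact eventually_atTop.1 (this.eventually (hU.mem_nhds hz₀))
    refine aestronglyMeasurable_of_tendsto_ae atTop
      (f := fun n : ℕ => fun t => (((n + N : ℕ) : ℂ) + 1) *
        (Φ (z₀ + 1 / (((n + N : ℕ) : ℂ) + 1)) (γ t) * deriv γ t - Φ z₀ (γ t) * deriv γ t))
      (fun n => ((hmeas _ (hN _ (Nat.le_add_left _ _))).sub (hmeas _ hz₀)).const_mul _) ?_
    refine (ae_restrict_iff' measurableSet_uIoc).2 (.of_forall fun t ht => ?_)
    have h1 := (hasDerivAt_iff_tendsto_slope.1 (hderiv z₀ hz₀ _ (hmem t ht)))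
    have h2 : Tendsto (fun n : ℕ => z₀ + 1 / (((n + N : ℕ) : ℂ) + 1)) atTop (𝓝[≠] z₀) := by
      refine tendsto_nhdsWithin_iff.2 ⟨?_, .of_forall fun n => ?_⟩
      · simpa using tendsto_const_nhds.add
          ((tendsto_one_div_add_atTop_nhds_zero_nat (𝕜 := ℂ)).comp (tendsto_add_atTop_nat N))
      · have : ((n + N : ℕ) : ℂ) + 1 ≠ 0 := Nat.cast_add_one_ne_zero _
        simpa using this
    refine ((h1.comp h2).mul_const (deriv γ t)).congr fun n => ?_
    have : ((n + N : ℕ) : ℂ) + 1 ≠ 0 := Nat.cast_add_one_ne_zero _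
    simp only [Function.comp_apply, slope_def_field]
    field_simp
    ring
  · refine .of_forall fun t ht z hz => ?_
    rw [norm_mul]
    refine mul_le_mul_of_nonneg_right ?_ (norm_nonneg _)
    have hsub : Metric.closedBall z (R / 2) ⊆ Metric.closedBall z₀ R :=
      Metric.closedBall_subset_closedBall' (by linarith [Metric.mem_ball.1 hz])
    -- Cauchy's estimate on discs of radius `R / 2` centred within `R / 2` of `z₀` supplies the
    -- dominating bound.
    refine Complex.norm_deriv_le_of_forall_mem_sphere_norm_le (half_pos hR) ?_ fun ζ hζ =>
      hC (ζ, γ t) ⟨hsub (Metric.sphere_subset_closedBall hζ), hmem t ht⟩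
    refine DifferentiableOn.diffContOnCl ((hd _ (hmem t ht)).mono ?_)
    exact Metric.closure_ball_subset_closedBall.trans (hsub.trans hRU)
  · refine .of_forall fun t ht z hz => (hderiv z (hRU ?_) _ (hmem t ht)).mul_const _
    exact Metric.ball_subset_closedBall (Metric.ball_subset_ball (by linarith) hz)

end IsSimpleClosedContour

/-! ### Cauchy's theorem and formula for simple closed contours -/

/-- The divided difference of a holomorphic function is jointly continuous. -/
lemma continuousOn_uncurry_dslope {F : ℂ → ℂ} {U : Set ℂ} (hU : IsOpen U)
    (hF : DifferentiableOn ℂ F U) :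
    ContinuousOn (fun p : ℂ × ℂ => dslope F p.2 p.1) (U ×ˢ U) := by
  rintro ⟨a, b⟩ ⟨ha, hb⟩
  refine ContinuousAt.continuousWithinAt ?_
  rcases eq_or_ne a b with rfl | hab
  -- On the diagonal, strict differentiability controls quotients whose two points both move; nearby
  -- diagonal values are handled by continuity of the derivative.
  · have hs : HasStrictDerivAt F (deriv F a) a :=
      (hF.analyticAt (hU.mem_nhds ha)).hasStrictDerivAt
    have hc : ContinuousAt (deriv F) a := (hF.analyticAt (hU.mem_nhds ha)).deriv.continuousAt
    have hc2 : ContinuousAt (fun p : ℂ × ℂ => deriv F p.2) (a, a) :=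
      ContinuousAt.comp (f := Prod.snd) (g := deriv F) hc continuousAt_snd
    rw [Metric.continuousAt_iff'] at hc2 ⊢
    intro ε hε
    filter_upwards [hs.isLittleO.def (half_pos hε), hc2 ε hε] with ⟨z, w⟩ h1 h2
    simp only [dslope_same] at h1 h2 ⊢
    rcases eq_or_ne z w with rfl | hzw
    · simpa using h2
    · rw [dslope_of_ne _ hzw, slope_def_field, dist_eq_norm]
      have hne : z - w ≠ 0 := sub_ne_zero.2 hzw
      have : (F z - F w) / (z - w) - deriv F a
          = (F z - F w - (z - w) * deriv F a) / (z - w) := by field_simp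
      rw [this, norm_div, div_lt_iff₀ (norm_pos_iff.2 hne)]
      have hpos := norm_pos_iff.2 hne
      have h3 : ‖F z - F w - (z - w) * deriv F a‖ ≤ ε / 2 * ‖z - w‖ := by simpa using h1
      nlinarith
  · have hev : (fun p : ℂ × ℂ => dslope F p.2 p.1) =ᶠ[𝓝 (a, b)]
        fun p => (F p.1 - F p.2) / (p.1 - p.2) := by
      have : ∀ᶠ p : ℂ × ℂ in 𝓝 (a, b), p.1 ≠ p.2 :=
        (isOpen_ne_fun continuous_fst continuous_snd).mem_nhds hab
      filter_upwards [this] with p hp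
      rw [dslope_of_ne _ hp, slope_def_field]
    refine ContinuousAt.congr ?_ hev.symm
    have hFa : ContinuousAt F a := (hF.differentiableAt (hU.mem_nhds ha)).continuousAt
    have hFb : ContinuousAt F b := (hF.differentiableAt (hU.mem_nhds hb)).continuousAt
    exact ((ContinuousAt.comp (f := Prod.fst) (x := (a, b)) hFa continuousAt_fst).sub
      (ContinuousAt.comp (f := Prod.snd) (x := (a, b)) hFb continuousAt_snd)).div
      (continuousAt_fst.sub continuousAt_snd) (sub_ne_zero.2 hab)

namespace IsSimpleClosedContour

variable {γ : ℝ → ℂ}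

lemma contourIntegral_congr {F G : ℂ → ℂ} (h : Set.EqOn F G (contourImage γ)) :
    contourIntegral γ F = contourIntegral γ G := by
  refine intervalIntegral.integral_congr fun t ht => ?_
  rw [Set.uIcc_of_le zero_le_one] at ht
  simp only [h (Set.mem_image_of_mem γ ht)]

lemma contourIntegral_const_mul (c : ℂ) (F : ℂ → ℂ) :
    contourIntegral γ (fun w => c * F w) = c * contourIntegral γ F := by
  simp only [contourIntegral, mul_assoc, intervalIntegral.integral_const_mul]

lemma contourIntegral_sub (hγ : IsSimpleClosedContour γ) {F G : ℂ → ℂ}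
    (hF : ContinuousOn F (contourImage γ)) (hG : ContinuousOn G (contourImage γ)) :
    contourIntegral γ (fun w => F w - G w) = contourIntegral γ F - contourIntegral γ G := by
  simp only [contourIntegral, sub_mul]
  exact intervalIntegral.integral_sub (hγ.intervalIntegrable hF) (hγ.intervalIntegrable hG)

lemma sub_ne_zero_of_notMem {z w : ℂ} (hz : z ∉ contourImage γ) (hw : w ∈ contourImage γ) :
    w - z ≠ 0 := sub_ne_zero.2 fun h => hz (h ▸ hw)

lemma continuousOn_div_sub {F : ℂ → ℂ} (hF : ContinuousOn F (contourImage γ)) {z : ℂ}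
    (hz : z ∉ contourImage γ) : ContinuousOn (fun w => F w / (w - z)) (contourImage γ) :=
  hF.div (by fun_prop) fun _ hw => sub_ne_zero_of_notMem hz hw

lemma contourIntegral_inv_sub_sq (hγ : IsSimpleClosedContour γ) {z : ℂ}
    (hz : z ∉ contourImage γ) : contourIntegral γ (fun w => ((w - z) ^ 2)⁻¹) = 0 := by
  refine hγ.contourIntegral_eq_zero_of_hasDerivAt (P := fun w => -(w - z)⁻¹) (fun w hw => ?_) ?_
  · have h := (((hasDerivAt_id w).sub_const z).inv (sub_ne_zero_of_notMem hz hw)).neg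
    convert! h using 1
    simp [neg_div]
  · exact ContinuousOn.inv₀ (by fun_prop) fun w hw => pow_ne_zero 2 (sub_ne_zero_of_notMem hz hw)

lemma hasDerivAt_cauchyTransform (hγ : IsSimpleClosedContour γ) {F : ℂ → ℂ}
    (hF : ContinuousOn F (contourImage γ)) {z : ℂ} (hz : z ∉ contourImage γ) :
    HasDerivAt (fun z => contourIntegral γ fun w => F w / (w - z))
      (contourIntegral γ fun w => F w * ((w - z) ^ 2)⁻¹) z := by
  have hd : ∀ w ∈ contourImage γ, ∀ z ∈ (contourImage γ)ᶜ,
      HasDerivAt (fun z => F w / (w - z)) (F w * ((w - z) ^ 2)⁻¹) z := fun w hw z hz => by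
    have h := (((hasDerivAt_id z).const_sub w).inv (sub_ne_zero_of_notMem hz hw)).const_mul (F w)
    convert! h using 1
    simp
  have h := hγ.hasDerivAt_contourIntegral (U := (contourImage γ)ᶜ) (Φ := fun z w => F w / (w - z))
    hγ.isCompact_image.isClosed.isOpen_compl ?_ (fun w hw z hz =>
      (hd w hw z hz).differentiableAt.differentiableWithinAt) hz
  · convert! h using 1
    exact contourIntegral_congr fun w hw => (hd w hw z hz).deriv.symm
  · refine ContinuousOn.div (hF.comp continuousOn_snd fun p hp => hp.2) (by fun_prop) ?_
    exact fun p hp => sub_ne_zero_of_notMem hp.1 hp.2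

lemma tendsto_cauchyTransform (hγ : IsSimpleClosedContour γ) {F : ℂ → ℂ}
    (hF : ContinuousOn F (contourImage γ)) :
    Tendsto (fun z => contourIntegral γ fun w => F w / (w - z)) (cocompact ℂ) (𝓝 0) := by
  obtain ⟨C, hC⟩ := hγ.isCompact_image.exists_bound_of_continuousOn hF
  obtain ⟨R, hR⟩ := hγ.isCompact_image.exists_bound_of_continuousOn (f := fun w => w) (by fun_prop)
  have hlim : Tendsto (fun z : ℂ => C / (‖z‖ - R) * ∫ t in (0 : ℝ)..1, ‖deriv γ t‖)
      (cocompact ℂ) (𝓝 0) := by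
    have h1 : Tendsto (fun z : ℂ => ‖z‖ - R) (cocompact ℂ) atTop :=
      tendsto_atTop_add_const_right _ _ (tendsto_norm_cocompact_atTop)
    simpa using (h1.const_div_atTop C).mul_const (∫ t in (0 : ℝ)..1, ‖deriv γ t‖)
  refine squeeze_zero_norm' ?_ hlim
  filter_upwards [(tendsto_norm_cocompact_atTop (E := ℂ)).eventually_gt_atTop R] with z hz
  refine hγ.norm_contourIntegral_le fun w hw => ?_
  rw [norm_div]
  have h1 : ‖z‖ - R ≤ ‖w - z‖ := by
    have := norm_sub_norm_le z w
    rw [norm_sub_rev] at this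
    linarith [hR w hw]
  exact div_le_div₀ ((norm_nonneg _).trans (hC w hw)) (hC w hw) (by linarith) h1

/-- A contour has winding number zero around the points it does not enclose. -/
lemma contourIntegral_inv_sub_eq_zero (hγ : IsSimpleClosedContour γ) {z : ℂ}
    (hz : z ∉ contourImage γ) (hz' : z ∉ contourInterior γ) :
    contourIntegral γ (fun w => 1 / (w - z)) = 0 := by
  set S := connectedComponentIn (contourImage γ)ᶜ z
  have hS : ¬ Bornology.IsBounded S := fun h => hz' ⟨hz, h⟩
  have hsub : S ⊆ (contourImage γ)ᶜ := connectedComponentIn_subset _ _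
  -- The derivative in `x` is the integral of `(w - x) ^ (-2)`, which has a primitive along the
  -- curve. So the winding integral is constant on the unbounded component, and its limit at
  -- infinity is `0`.
  have hd : ∀ x ∈ S, HasDerivAt (fun z => contourIntegral γ fun w => 1 / (w - z)) 0 x :=
    fun x hx => by
      have := hγ.hasDerivAt_cauchyTransform (F := fun _ => 1) continuousOn_const (hsub hx)
      simpa [hγ.contourIntegral_inv_sub_sq (hsub hx)] using this
  have hconst : ∀ x ∈ S, contourIntegral γ (fun w => 1 / (w - x))
      = contourIntegral γ (fun w => 1 / (w - z)) := fun x hx =>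
    (hγ.isCompact_image.isClosed.isOpen_compl.connectedComponentIn).is_const_of_deriv_eq_zero
      isPreconnected_connectedComponentIn
      (fun y hy => (hd y hy).differentiableAt.differentiableWithinAt)
      (fun y hy => (hd y hy).deriv) hx (mem_connectedComponentIn hz)
  have hne : (cocompact ℂ ⊓ 𝓟 S).NeBot := by
    rw [← Metric.cobounded_eq_cocompact, ← frequently_mem_iff_neBot]
    intro h
    exact hS (Bornology.isBounded_def.2 h)
  refine tendsto_nhds_unique (f := fun z => contourIntegral γ fun w => 1 / (w - z))
    (l := cocompact ℂ ⊓ 𝓟 S) ?_ ((hγ.tendsto_cauchyTransform continuousOn_const).mono_left inf_le_left)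
  refine tendsto_const_nhds.congr' ?_
  filter_upwards [mem_inf_of_right (mem_principal_self S)] with x hx using (hconst x hx).symm

lemma isOpen_exterior (hγ : IsSimpleClosedContour γ) :
    IsOpen (contourImage γ ∪ contourInterior γ)ᶜ := by
  refine isOpen_iff_mem_nhds.2 fun z hz => ?_
  simp only [Set.mem_compl_iff, Set.mem_union, not_or] at hz
  filter_upwards [(hγ.isCompact_image.isClosed.isOpen_compl.connectedComponentIn).mem_nhds
    (mem_connectedComponentIn (x := z) hz.1)] with y hy
  simp only [Set.mem_compl_iff, Set.mem_union, not_or]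
  refine ⟨connectedComponentIn_subset _ _ hy, fun h => hz.2 ⟨hz.1, ?_⟩⟩
  rw [connectedComponentIn_eq hy]
  exact h.2

/-- Beyond the radius of the curve, the ray from `z` away from the origin misses the curve, so the
component of `z` is unbounded. -/
lemma eventually_exterior (hγ : IsSimpleClosedContour γ) :
    ∀ᶠ z in cocompact ℂ, z ∉ contourImage γ ∧ z ∉ contourInterior γ := by
  obtain ⟨R, hR⟩ := hγ.isCompact_image.exists_bound_of_continuousOn (f := fun w => w) (by fun_prop)
  filter_upwards [(tendsto_norm_cocompact_atTop (E := ℂ)).eventually_gt_atTop (max R 0)] with z hz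
  have hz0 : 0 < ‖z‖ := (le_max_right _ _).trans_lt hz
  have hray : (fun t : ℝ => (t : ℂ) * z) '' Set.Ici 1 ⊆ (contourImage γ)ᶜ := by
    rintro _ ⟨t, ht, rfl⟩ hmem
    have h1 := hR _ hmem
    have ht1 : (1 : ℝ) ≤ t := ht
    simp only [norm_mul, Complex.norm_real, Real.norm_eq_abs] at h1
    have : ‖z‖ ≤ |t| * ‖z‖ := le_mul_of_one_le_left hz0.le (ht1.trans (le_abs_self t))
    linarith [le_max_left R 0]
  have hzmem : z ∈ (fun t : ℝ => (t : ℂ) * z) '' Set.Ici 1 := ⟨1, Set.self_mem_Ici, by simp⟩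
  refine ⟨hray hzmem, fun h => ?_⟩
  have hsub : (fun t : ℝ => (t : ℂ) * z) '' Set.Ici 1 ⊆ connectedComponentIn (contourImage γ)ᶜ z :=
    (isPreconnected_Ici.image _ (by fun_prop)).subset_connectedComponentIn hzmem hray
  obtain ⟨C, hC⟩ := (h.2.subset hsub).exists_norm_le
  have h1 := hC _ ⟨max 1 (C / ‖z‖ + 1), Set.mem_Ici.2 (le_max_left _ _), rfl⟩
  simp only [norm_mul, Complex.norm_real, Real.norm_eq_abs] at h1
  have h2 : C / ‖z‖ + 1 ≤ |max 1 (C / ‖z‖ + 1)| := (le_max_right _ _).trans (le_abs_self _)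
  have h3 := mul_le_mul_of_nonneg_right h2 hz0.le
  rw [add_mul, div_mul_cancel₀ _ hz0.ne'] at h3
  linarith

/-- The homology form of Cauchy's theorem, by Dixon's argument. -/
lemma contourIntegral_dslope_eq_zero (hγ : IsSimpleClosedContour γ) {U : Set ℂ} (hU : IsOpen U)
    (hγU : contourImage γ ⊆ U) (hint : contourInterior γ ⊆ U) {F : ℂ → ℂ}
    (hF : DifferentiableOn ℂ F U) {z : ℂ} (hz : z ∈ U) :
    contourIntegral γ (fun w => dslope F w z) = 0 := by
  classical
  have hFc : ContinuousOn F (contourImage γ) := hF.continuousOn.mono hγU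
  have hagree : ∀ x ∈ (contourImage γ ∪ contourInterior γ)ᶜ,
      contourIntegral γ (fun w => dslope F w x) = contourIntegral γ fun w => F w / (w - x) := by
    intro x hx
    simp only [Set.mem_compl_iff, Set.mem_union, not_or] at hx
    have h1 : contourIntegral γ (fun w => dslope F w x)
        = contourIntegral γ (fun w => F w / (w - x) - F x * (1 / (w - x))) := by
      refine contourIntegral_congr fun w hw => ?_
      have hne := sub_ne_zero_of_notMem hx.1 hw
      have hne' : x - w ≠ 0 := by rw [← neg_sub]; exact neg_ne_zero.2 hne
      rw [dslope_of_ne _ (sub_ne_zero.1 hne'), slope_def_field]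
      field_simp
      ring
    rw [h1, hγ.contourIntegral_sub (G := fun w => F x * (1 / (w - x)))
      (continuousOn_div_sub hFc hx.1)
      (continuousOn_const.mul (continuousOn_div_sub continuousOn_const hx.1)),
      contourIntegral_const_mul, hγ.contourIntegral_inv_sub_eq_zero hx.1 hx.2, mul_zero, sub_zero]
  -- The two formulas agree off the curve and its interior because the winding number vanishes
  -- there. The glued function is entire and tends to `0` at infinity, so Liouville makes it zero.
  set h : ℂ → ℂ := fun x => if x ∈ U then contourIntegral γ (fun w => dslope F w x)
    else contourIntegral γ fun w => F w / (w - x) with hh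
  have hext : ∀ x ∈ (contourImage γ ∪ contourInterior γ)ᶜ,
      h x = contourIntegral γ fun w => F w / (w - x) := fun x hx => by
    simp only [hh]
    split_ifs
    exacts [hagree x hx, rfl]
  have hdiff : Differentiable ℂ h := fun x => by
    by_cases hx : x ∈ U
    · have hd := hγ.hasDerivAt_contourIntegral hU (Φ := fun z w => dslope F w z)
        ((continuousOn_uncurry_dslope hU hF).mono (Set.prod_mono subset_rfl hγU))
        (fun w hw => (Complex.differentiableOn_dslope (hU.mem_nhds (hγU hw))).2 hF) hx
      refine hd.differentiableAt.congr_of_eventuallyEq ?_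
      filter_upwards [hU.mem_nhds hx] with y hy
      simp only [hh, if_pos hy]
    · have hx' : x ∈ (contourImage γ ∪ contourInterior γ)ᶜ :=
        fun hmem => hx (hmem.elim (@hγU x) (@hint x))
      refine (hγ.hasDerivAt_cauchyTransform hFc fun hmem => hx (hγU hmem)).differentiableAt
        |>.congr_of_eventuallyEq ?_
      filter_upwards [hγ.isOpen_exterior.mem_nhds hx'] with y hy using hext y hy
  have hlim : Tendsto h (cocompact ℂ) (𝓝 0) := by
    refine (hγ.tendsto_cauchyTransform hFc).congr' ?_
    filter_upwards [hγ.eventually_exterior] with x hx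
    exact (hext x (by simpa using hx)).symm
  have := hdiff.apply_eq_of_tendsto_cocompact z hlim
  simpa only [hh, if_pos hz] using this

/-- Cauchy's integral formula for the derivative. -/
lemma contourIntegral_mul_inv_sub_sq (hγ : IsSimpleClosedContour γ)
    (hpos : IsPositivelyOriented γ) {U : Set ℂ} (hU : IsOpen U)
    (hγU : contourImage γ ⊆ U) (hint : contourInterior γ ⊆ U) {F : ℂ → ℂ}
    (hF : DifferentiableOn ℂ F U) {x : ℂ} (hx : x ∈ contourInterior γ) :
    contourIntegral γ (fun w => F w * ((w - x) ^ 2)⁻¹)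
      = 2 * (Real.pi : ℂ) * Complex.I * deriv F x := by
  have hxU := hint hx
  have hq : DifferentiableOn ℂ (dslope F x) U :=
    (Complex.differentiableOn_dslope (hU.mem_nhds hxU)).2 hF
  -- The vanishing theorem is applied to the divided difference `dslope F x`. Its own divided
  -- difference expands into `F w / (w - x) ^ 2`, a multiple of `(w - x) ^ (-2)` with zero integral,
  -- and `F' x / (w - x)`.
  have h0 := hγ.contourIntegral_dslope_eq_zero hU hγU hint hq hxU
  have h1 : contourIntegral γ (fun w => dslope (dslope F x) w x)
      = contourIntegral γ (fun w => (F w * ((w - x) ^ 2)⁻¹ - F x * ((w - x) ^ 2)⁻¹)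
        - deriv F x * (w - x)⁻¹) := by
    refine contourIntegral_congr fun w hw => ?_
    have hne := sub_ne_zero_of_notMem hx.1 hw
    have hne' : x - w ≠ 0 := by rw [← neg_sub]; exact neg_ne_zero.2 hne
    rw [dslope_of_ne _ (sub_ne_zero.1 hne'), slope_def_field, dslope_same,
      dslope_of_ne _ (sub_ne_zero.1 hne), slope_def_field]
    field_simp
    ring
  have hc : ContinuousOn (fun w => ((w - x) ^ 2)⁻¹) (contourImage γ) :=
    ContinuousOn.inv₀ (by fun_prop) fun w hw => pow_ne_zero 2 (sub_ne_zero_of_notMem hx.1 hw)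
  have hc' : ContinuousOn (fun w => (w - x)⁻¹) (contourImage γ) :=
    ContinuousOn.inv₀ (by fun_prop) fun w hw => sub_ne_zero_of_notMem hx.1 hw
  have hFc : ContinuousOn F (contourImage γ) := hF.continuousOn.mono hγU
  rw [h0, hγ.contourIntegral_sub
    (F := fun w => F w * ((w - x) ^ 2)⁻¹ - F x * ((w - x) ^ 2)⁻¹)
    (G := fun w => deriv F x * (w - x)⁻¹)
    ((hFc.mul hc).sub (continuousOn_const.mul hc)) (continuousOn_const.mul hc'),
    hγ.contourIntegral_sub (F := fun w => F w * ((w - x) ^ 2)⁻¹)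
    (G := fun w => F x * ((w - x) ^ 2)⁻¹) (hFc.mul hc) (continuousOn_const.mul hc),
    contourIntegral_const_mul, contourIntegral_const_mul, hγ.contourIntegral_inv_sub_sq hx.1,
    mul_zero, sub_zero] at h1
  have h2 := hpos x hx
  rw [inv_mul_eq_one₀ Complex.two_pi_I_ne_zero] at h2
  rw [← h2] at h1
  linear_combination -h1

end IsSimpleClosedContour

/-! ### The Banach algebra `C([-M, M], ℂ)`: density, primitives and resolvents -/

namespace SegmentSpace

variable {M : ℝ}

/-- The monomial `x ^ n` as a continuous function on `[-M, M]`. -/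
def monomial (M : ℝ) (n : ℕ) : C(Set.Icc (-M) M, ℂ) :=
  ⟨fun x => ((x : ℝ) : ℂ) ^ n, by fun_prop⟩

/-- The monomials span a dense subspace of `C([-M, M], ℂ)`. -/
lemma eq_top_of_monomial_mem (S : Submodule ℂ C(Set.Icc (-M) M, ℂ))
    (hS : IsClosed (S : Set C(Set.Icc (-M) M, ℂ))) (h : ∀ n, monomial M n ∈ S) : S = ⊤ := by
  -- Real Weierstrass approximation is transported along the inclusion `J`; real and imaginary parts
  -- then cover complex functions.
  let J : C(Set.Icc (-M) M, ℝ) → C(Set.Icc (-M) M, ℂ) :=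
    fun f => (⟨fun x : ℝ => (x : ℂ), Complex.continuous_ofReal⟩ : C(ℝ, ℂ)).comp f
  have hJ : Continuous J := ContinuousMap.continuous_postcomp _
  have hpoly : ∀ p : Polynomial ℝ, J (p.toContinuousMapOn _) ∈ S := fun p => by
    induction p using Polynomial.induction_on' with
    | add p q hp hq =>
      convert! S.add_mem hp hq using 1
      ext x
      simp [J]
    | monomial n a =>
      convert! S.smul_mem (a : ℂ) (h n) using 1
      ext x
      simp [J, monomial]
  have hreal : ∀ f, J f ∈ S := fun f => by
    have hf := continuousMap_mem_polynomialFunctions_closure (-M) M f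
    have hcl : IsClosed (J ⁻¹' (S : Set C(Set.Icc (-M) M, ℂ))) := hS.preimage hJ
    refine hcl.closure_subset_iff.2 ?_ hf
    intro g hg
    obtain ⟨p, rfl⟩ : g ∈ Set.range (Polynomial.toContinuousMapOnAlgHom (Set.Icc (-M) M)) := by
      rw [← polynomialFunctions_coe]
      exact hg
    exact hpoly p
  refine eq_top_iff.2 fun v _ => ?_
  have hv : v = J ((⟨Complex.re, Complex.continuous_re⟩ : C(ℂ, ℝ)).comp v)
      + Complex.I • J ((⟨Complex.im, Complex.continuous_im⟩ : C(ℂ, ℝ)).comp v) := by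
    ext x
    simp only [ContinuousMap.add_apply, ContinuousMap.smul_apply, J, ContinuousMap.comp_apply,
      ContinuousMap.coe_mk, smul_eq_mul]
    rw [mul_comm, Complex.re_add_im]
  rw [hv]
  exact S.add_mem (hreal _) (S.smul_mem _ (hreal _))

/-- Two continuous bilinear forms on `C([-M, M], ℂ)` that agree on monomials are equal. -/
lemma bilinear_ext {B B' : C(Set.Icc (-M) M, ℂ) →L[ℂ] C(Set.Icc (-M) M, ℂ) →L[ℂ] ℂ}
    (h : ∀ m n, B (monomial M m) (monomial M n) = B' (monomial M m) (monomial M n)) : B = B' := by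
  have h1 : ∀ n v, B v (monomial M n) = B' v (monomial M n) := fun n v => by
    have := eq_top_of_monomial_mem
      (LinearMap.ker (B.flip (monomial M n) - B'.flip (monomial M n)).toLinearMap)
      (B.flip (monomial M n) - B'.flip (monomial M n)).isClosed_ker (fun m => by simp [h])
    have hv : v ∈ LinearMap.ker (B.flip (monomial M n) - B'.flip (monomial M n)).toLinearMap :=
      this ▸ trivial
    simpa [sub_eq_zero] using hv
  ext1 v
  ext1 w
  have := eq_top_of_monomial_mem (LinearMap.ker (B v - B' v).toLinearMap)
    (B v - B' v).isClosed_ker (fun m => by simp [h1])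
  have hw : w ∈ LinearMap.ker (B v - B' v).toLinearMap := this ▸ trivial
  simpa [sub_eq_zero] using hw

lemma norm_monomial_le (hM : 0 < M) (n : ℕ) : ‖monomial M n‖ ≤ M ^ n := by
  refine (ContinuousMap.norm_le _ (by positivity)).2 fun x => ?_
  simp only [monomial, ContinuousMap.coe_mk, norm_pow, Complex.norm_real, Real.norm_eq_abs]
  exact pow_le_pow_left₀ (abs_nonneg _) (abs_le.2 x.2) n

/-- The derivative of a `C¹` function, restricted to `[-M, M]`. -/
noncomputable def derivOn (M : ℝ) (f : ℝ → ℂ) (hf : ContDiff ℝ 1 f) : C(Set.Icc (-M) M, ℂ) :=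
  ⟨fun x => deriv f x, (hf.continuous_deriv le_rfl).comp continuous_subtype_val⟩

lemma norm_derivOn (M : ℝ) (f : ℝ → ℂ) (hf : ContDiff ℝ 1 f) :
    ‖derivOn M f hf‖ = supNormOn M (deriv f) :=
  ContinuousMap.norm_eq_iSup_norm _

/-- A nondegenerate interval determines derivatives even at its endpoints. Thus the derivative on
`[-M, M]` does not depend on the chosen extension. -/
lemma deriv_eq_of_eqOn (hM : 0 < M) {f g : ℝ → ℂ} {x f' g' : _}
    (hf : HasDerivAt f f' x) (hg : HasDerivAt g g' x)
    (h : Set.EqOn f g (Set.Icc (-M) M)) (hx : x ∈ Set.Icc (-M) M) : f' = g' := by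
  have hu : UniqueDiffWithinAt ℝ (Set.Icc (-M) M) x :=
    uniqueDiffOn_Icc (by linarith) x hx
  exact hu.eq_deriv _ hf.hasDerivWithinAt
    (hg.hasDerivWithinAt.congr (fun y hy => h hy) (h hx))

lemma derivOn_congr (hM : 0 < M) {f g : ℝ → ℂ} (hf : ContDiff ℝ 1 f) (hg : ContDiff ℝ 1 g)
    (h : Set.EqOn f g (Set.Icc (-M) M)) : derivOn M f hf = derivOn M g hg := by
  ext x
  exact deriv_eq_of_eqOn hM (hf.differentiable one_ne_zero _).hasDerivAt
    (hg.differentiable one_ne_zero _).hasDerivAt h x.2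

/-- The primitive, vanishing at `0`, of the extension of `v` to `ℝ` that is constant on both sides
of `[-M, M]`. -/
noncomputable def primitive (hM : 0 < M) (v : C(Set.Icc (-M) M, ℂ)) (x : ℝ) : ℂ :=
  ∫ t in (0 : ℝ)..x, Set.IccExtend (neg_le_self hM.le) v t

lemma continuous_IccExtend (hM : 0 < M) (v : C(Set.Icc (-M) M, ℂ)) :
    Continuous (Set.IccExtend (neg_le_self hM.le) v) :=
  v.continuous.Icc_extend'

lemma norm_IccExtend_le (hM : 0 < M) (v : C(Set.Icc (-M) M, ℂ)) (x : ℝ) :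
    ‖Set.IccExtend (neg_le_self hM.le) v x‖ ≤ ‖v‖ :=
  v.norm_coe_le_norm _

lemma hasDerivAt_primitive (hM : 0 < M) (v : C(Set.Icc (-M) M, ℂ)) (x : ℝ) :
    HasDerivAt (primitive hM v) (Set.IccExtend (neg_le_self hM.le) v x) x :=
  (continuous_IccExtend hM v).integral_hasStrictDerivAt 0 x |>.hasDerivAt

lemma deriv_primitive (hM : 0 < M) (v : C(Set.Icc (-M) M, ℂ)) :
    deriv (primitive hM v) = Set.IccExtend (neg_le_self hM.le) v :=
  funext fun x => (hasDerivAt_primitive hM v x).deriv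

lemma contDiff_primitive (hM : 0 < M) (v : C(Set.Icc (-M) M, ℂ)) :
    ContDiff ℝ 1 (primitive hM v) := by
  refine contDiff_one_iff_deriv.2
    ⟨fun x => (hasDerivAt_primitive hM v x).differentiableAt, ?_⟩
  rw [deriv_primitive]
  exact continuous_IccExtend hM v

lemma derivOn_primitive (hM : 0 < M) (v : C(Set.Icc (-M) M, ℂ)) :
    derivOn M (primitive hM v) (contDiff_primitive hM v) = v := by
  ext x
  simp [derivOn, deriv_primitive]

lemma norm_primitive_le (hM : 0 < M) (v : C(Set.Icc (-M) M, ℂ)) (x : ℝ) :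
    ‖primitive hM v x‖ ≤ ‖v‖ * |x| := by
  have := intervalIntegral.norm_integral_le_of_norm_le_const (a := 0) (b := x)
    fun t _ => norm_IccExtend_le hM v t
  simpa [primitive] using this

lemma primitive_add (hM : 0 < M) (v w : C(Set.Icc (-M) M, ℂ)) :
    primitive hM (v + w) = primitive hM v + primitive hM w :=
  funext fun _ => intervalIntegral.integral_add ((continuous_IccExtend hM v).intervalIntegrable _ _)
    ((continuous_IccExtend hM w).intervalIntegrable _ _)

lemma primitive_smul (hM : 0 < M) (c : ℂ) (v : C(Set.Icc (-M) M, ℂ)) :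
    primitive hM (c • v) = c • primitive hM v :=
  funext fun _ => intervalIntegral.integral_smul c _

lemma eqOn_primitive_derivOn (hM : 0 < M) (f : ℝ → ℂ) (hf : ContDiff ℝ 1 f) :
    Set.EqOn f (fun x => f 0 + primitive hM (derivOn M f hf) x) (Set.Icc (-M) M) := by
  intro x hx
  have h1 : primitive hM (derivOn M f hf) x = ∫ t in (0 : ℝ)..x, deriv f t := by
    refine intervalIntegral.integral_congr fun t ht => ?_
    have ht' : t ∈ Set.Icc (-M) M :=
      (Set.uIcc_subset_Icc (by constructor <;> linarith) hx : Set.uIcc 0 x ⊆ _) ht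
    simp only [Set.IccExtend_of_mem _ _ ht', derivOn, ContinuousMap.coe_mk]
  have h2 := intervalIntegral.integral_eq_sub_of_hasDerivAt (a := 0) (b := x) (f := f)
    (fun t _ => (hf.differentiable one_ne_zero t).hasDerivAt)
    ((hf.continuous_deriv le_rfl).intervalIntegrable _ _)
  simp [h1, h2]

lemma contDiff_ofReal_pow (n : ℕ) : ContDiff ℝ 1 fun x : ℝ => (x : ℂ) ^ n :=
  Complex.ofRealCLM.contDiff.pow n

lemma derivOn_pow (n : ℕ) (h : ContDiff ℝ 1 fun x : ℝ => (x : ℂ) ^ (n + 1)) :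
    derivOn M (fun x : ℝ => (x : ℂ) ^ (n + 1)) h = ((n : ℂ) + 1) • monomial M n := by
  ext x
  have h1 := (Complex.ofRealCLM.hasDerivAt (x := (x : ℝ))).pow (n + 1)
  have h2 : HasDerivAt (fun x : ℝ => (x : ℂ) ^ (n + 1)) (((n : ℂ) + 1) * ((x : ℝ) : ℂ) ^ n) x := by
    convert! h1 using 1
    simp
  exact h2.deriv

lemma derivOn_const (c : ℂ) : derivOn M (fun _ => c) contDiff_const = 0 := by
  ext x
  simp [derivOn]

/-- The function `x ↦ (z - x) ^ (-2)` on `[-M, M]`. -/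
noncomputable def resolventSq (M : ℝ) (z : ℂ) : C(Set.Icc (-M) M, ℂ) :=
  Ring.inverse ((algebraMap ℂ C(Set.Icc (-M) M, ℂ) z - monomial M 1) ^ 2)

lemma isUnit_algebraMap_sub {z : ℂ} (hz : z ∉ realSegment M) :
    IsUnit ((algebraMap ℂ C(Set.Icc (-M) M, ℂ) z - monomial M 1) ^ 2) := by
  refine IsUnit.pow 2 (ContinuousMap.isUnit_iff_forall_ne_zero _ |>.2 fun x hx => hz ⟨x, x.2, ?_⟩)
  simpa [monomial, sub_eq_zero, eq_comm] using hx

lemma resolventSq_apply {z : ℂ} (hz : z ∉ realSegment M) (x : Set.Icc (-M) M) :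
    resolventSq M z x = ((z - (x : ℝ)) ^ 2)⁻¹ := by
  have h := congrArg (fun v : C(Set.Icc (-M) M, ℂ) => v x)
    (Ring.inverse_mul_cancel _ (isUnit_algebraMap_sub hz))
  refine eq_inv_of_mul_eq_one_left ?_
  simpa [monomial, resolventSq] using! h

/-- Inversion in a Banach algebra is analytic at units, and `(z - x) ^ 2` is a unit for `z` off the
segment. -/
lemma analyticAt_resolventSq {z : ℂ} (hz : z ∉ realSegment M) :
    AnalyticAt ℂ (resolventSq M) z := by
  have h1 : AnalyticAt ℂ
      (fun z : ℂ => (algebraMap ℂ C(Set.Icc (-M) M, ℂ) z - monomial M 1) ^ 2) z := by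
    refine AnalyticAt.pow (AnalyticAt.sub ?_ analyticAt_const) 2
    exact (Algebra.linearMap ℂ C(Set.Icc (-M) M, ℂ)).toContinuousLinearMap.analyticAt z
  obtain ⟨w, hw⟩ := isUnit_algebraMap_sub hz
  have h2 := analyticAt_inverse (𝕜 := ℂ) w
  rw [hw] at h2
  exact AnalyticAt.comp (f := fun z : ℂ => (algebraMap ℂ C(Set.Icc (-M) M, ℂ) z - monomial M 1) ^ 2)
    h2 h1

lemma notMem_realSegment_of_lt_norm {z : ℂ} (hz : M < ‖z‖) : z ∉ realSegment M := by
  rintro ⟨x, hx, rfl⟩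
  rw [Complex.norm_real, Real.norm_eq_abs] at hz
  exact absurd (abs_le.2 hx) (not_le.2 hz)

lemma summable_norm_resolventSq (hM : 0 < M) {z : ℂ} (hz : M < ‖z‖) :
    Summable fun m : ℕ => ‖(((m : ℂ) + 1) / z ^ (m + 2)) • monomial M m‖ := by
  have hz0 : 0 < ‖z‖ := hM.trans hz
  have hr : ‖M / ‖z‖‖ < 1 := by
    rw [Real.norm_eq_abs, abs_of_nonneg (by positivity), div_lt_one hz0]
    exact hz
  have h := ((hasSum_choose_mul_geometric_of_norm_lt_one 1 hr).summable).mul_left (1 / ‖z‖ ^ 2)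
  refine Summable.of_nonneg_of_le (fun _ => norm_nonneg _) (fun m => ?_) h
  rw [norm_smul, norm_div, norm_pow]
  have h1 : ‖(m : ℂ) + 1‖ = m + 1 := by
    rw [← Nat.cast_succ, Complex.norm_natCast, Nat.cast_succ]
  rw [h1, Nat.choose_one_right]
  calc ((m : ℝ) + 1) / ‖z‖ ^ (m + 2) * ‖monomial M m‖
      ≤ ((m : ℝ) + 1) / ‖z‖ ^ (m + 2) * M ^ m :=
        mul_le_mul_of_nonneg_left (norm_monomial_le hM m) (by positivity)
    _ = _ := by push_cast; rw [div_pow, pow_add]; field_simp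

/-- This is the differentiated geometric series in `x / z`. Normal convergence gives a sum in
`C([-M, M])`, which evaluation at points identifies. -/
lemma hasSum_resolventSq (hM : 0 < M) {z : ℂ} (hz : M < ‖z‖) :
    HasSum (fun m : ℕ => (((m : ℂ) + 1) / z ^ (m + 2)) • monomial M m) (resolventSq M z) := by
  have hz0 : z ≠ 0 := norm_pos_iff.1 (hM.trans hz)
  have hs := (summable_norm_resolventSq hM hz).of_norm
  convert! hs.hasSum
  ext x
  have h1 := (hs.hasSum.map (ContinuousMap.evalCLM ℂ x) (ContinuousMap.evalCLM ℂ x).continuous)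
  have hr : ‖((x : ℝ) : ℂ) / z‖ < 1 := by
    rw [norm_div, div_lt_one (hM.trans hz), Complex.norm_real]
    exact (abs_le.2 x.2).trans_lt hz
  have h2 := (hasSum_choose_mul_geometric_of_norm_lt_one 1 hr).mul_left (1 / z ^ 2)
  have hne : z - (x : ℝ) ≠ 0 := fun h0 =>
    notMem_realSegment_of_lt_norm hz ⟨x, x.2, (sub_eq_zero.1 h0).symm⟩
  rw [resolventSq_apply (notMem_realSegment_of_lt_norm hz)]
  refine HasSum.unique ?_ h1
  convert! h2 using 1
  · ext m
    simp only [Function.comp_apply, ContinuousMap.evalCLM_apply, ContinuousMap.smul_apply, monomial,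
      ContinuousMap.coe_mk, smul_eq_mul, Nat.choose_one_right, div_pow, pow_add]
    push_cast
    field_simp
  · rw [one_sub_div hz0, div_pow]
    field_simp
    ring

/-- A continuous bilinear map applied to two absolutely convergent series. -/
lemma hasSum_bilinear {V W : Type*} [NormedAddCommGroup V] [NormedSpace ℂ V]
    [NormedAddCommGroup W] [NormedSpace ℂ W] (B : V →L[ℂ] W →L[ℂ] ℂ)
    {a : ℕ → V} {b : ℕ → W} {v : V} {w : W} (ha : HasSum a v) (hb : HasSum b w)
    (ha' : Summable fun n => ‖a n‖) (hb' : Summable fun n => ‖b n‖) :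
    HasSum (fun p : ℕ × ℕ => B (a p.1) (b p.2)) (B v w) := by
  have hs : Summable fun p : ℕ × ℕ => B (a p.1) (b p.2) := by
    refine Summable.of_norm_bounded
      (((ha'.mul_of_nonneg hb' (fun _ => norm_nonneg _) fun _ => norm_nonneg _)).mul_left ‖B‖)
      fun p => ?_
    rw [← mul_assoc]
    exact B.le_opNorm₂ _ _
  have h1 : ∀ m, HasSum (fun n => B (a m) (b n)) (B (a m) w) := fun m => (B (a m)).hasSum hb
  have h2 : HasSum (fun m => B (a m) w) (B v w) := (B.flip w).hasSum ha
  have h3 := hs.hasSum.prod_fiberwise h1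
  rw [← h3.unique h2]
  exact hs.hasSum

/-- The set `M < ‖z‖` is the image of the punctured plane under pushing points radially outward by
`M`. Every other point off the segment reaches it along its outgoing ray, which misses the segment
because `[-M, M]` is star-shaped about `0`. -/
lemma isPreconnected_compl_realSegment (hM : 0 < M) : IsPreconnected (realSegment M)ᶜ := by
  have hext : IsPreconnected {z : ℂ | M < ‖z‖} := by
    have h0 : IsPreconnected ({0}ᶜ : Set ℂ) :=
      (isConnected_compl_singleton_of_one_lt_rank (by simp [Complex.rank_real_complex])
        0).isPreconnected
    have h1 := h0.image (fun z : ℂ => z + (M / ‖z‖ : ℝ) * z) (by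
      refine ContinuousOn.add continuousOn_id (ContinuousOn.mul ?_ continuousOn_id)
      exact Complex.continuous_ofReal.comp_continuousOn
        (continuousOn_const.div continuous_norm.continuousOn fun z hz => norm_ne_zero_iff.2 hz))
    convert! h1 using 1
    have hnorm : ∀ z : ℂ, z ≠ 0 → ‖z + (M / ‖z‖ : ℝ) * z‖ = ‖z‖ + M := fun z hz => by
      have hz0 : 0 < ‖z‖ := norm_pos_iff.2 hz
      have : z + (M / ‖z‖ : ℝ) * z = ((1 + M / ‖z‖ : ℝ) : ℂ) * z := by push_cast; ring
      rw [this, norm_mul, Complex.norm_real, Real.norm_eq_abs, abs_of_pos (by positivity)]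
      field_simp
    ext w
    constructor
    · intro hw
      have hw' : M < ‖w‖ := hw
      have hw0 : 0 < ‖w‖ := hM.trans hw'
      have hd : 0 < ‖w‖ - M := by linarith
      have hw0' : w ≠ 0 := norm_pos_iff.1 hw0
      have hdc : ((‖w‖ : ℂ) - M) ≠ 0 := by
        rw [← Complex.ofReal_sub]; exact Complex.ofReal_ne_zero.2 hd.ne'
      have hwc : (‖w‖ : ℂ) ≠ 0 := Complex.ofReal_ne_zero.2 hw0.ne'
      refine ⟨(((‖w‖ - M) / ‖w‖ : ℝ) : ℂ) * w, ?_, ?_⟩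
      · simp only [Set.mem_compl_iff, Set.mem_singleton_iff]
        exact mul_ne_zero (Complex.ofReal_ne_zero.2 (by positivity)) hw0'
      · have hn : ‖(((‖w‖ - M) / ‖w‖ : ℝ) : ℂ) * w‖ = ‖w‖ - M := by
          rw [norm_mul, Complex.norm_real, Real.norm_eq_abs, abs_of_pos (by positivity)]
          field_simp
        simp only [hn]
        push_cast
        field_simp
        ring
    · rintro ⟨z, hz, rfl⟩
      show M < ‖_‖
      rw [hnorm z hz]
      linarith [norm_pos_iff.2 hz]
  have hx0 : ((M + 1 : ℝ) : ℂ) ∈ {z : ℂ | M < ‖z‖} := by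
    show M < ‖_‖
    rw [Complex.norm_real, Real.norm_eq_abs, abs_of_pos (by linarith)]
    linarith
  refine isPreconnected_of_forall ((M + 1 : ℝ) : ℂ) fun z hz => ?_
  have hz0 : z ≠ 0 := fun h => hz ⟨0, by constructor <;> linarith, by simp [h]⟩
  have hzpos : 0 < ‖z‖ := norm_pos_iff.2 hz0
  have hray : IsPreconnected ((fun t : ℝ => (t : ℂ) * z) '' Set.Ici 1) :=
    isPreconnected_Ici.image _ (by fun_prop)
  refine ⟨{z : ℂ | M < ‖z‖} ∪ (fun t : ℝ => (t : ℂ) * z) '' Set.Ici 1, ?_, Or.inl hx0,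
    Or.inr ⟨1, Set.self_mem_Ici, by simp⟩, ?_⟩
  · rintro w (hw | ⟨t, ht, rfl⟩)
    · exact notMem_realSegment_of_lt_norm hw
    · rintro ⟨x, hx, hxt⟩
      have ht1 : (1 : ℝ) ≤ t := ht
      have ht0 : 0 < t := by linarith
      refine hz ⟨x / t, ?_, ?_⟩
      · have : |x / t| ≤ M := by
          rw [abs_div, abs_of_pos ht0, div_le_iff₀ ht0]
          nlinarith [abs_le.2 hx]
        exact abs_le.1 this
      · have : (t : ℂ) ≠ 0 := Complex.ofReal_ne_zero.2 ht0.ne'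
        simp only at hxt ⊢
        push_cast
        rw [hxt]
        field_simp
  · have hT : max 1 (M / ‖z‖ + 1) ∈ Set.Ici (1 : ℝ) := Set.mem_Ici.2 (le_max_left _ _)
    refine hext.union (((max 1 (M / ‖z‖ + 1) : ℝ) : ℂ) * z) ?_ ⟨_, hT, rfl⟩ hray
    show M < ‖_‖
    rw [norm_mul, Complex.norm_real, Real.norm_eq_abs,
      abs_of_pos (zero_lt_one.trans_le (le_max_left _ _))]
    have h3 := mul_le_mul_of_nonneg_right (le_max_right 1 (M / ‖z‖ + 1)) hzpos.le
    rw [add_mul, div_mul_cancel₀ _ hzpos.ne'] at h3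
    linarith

end SegmentSpace

/-! ### Linear statistics: measurability, moments and negligible tails -/

namespace SelfAdjointEnsemble

variable (E : SelfAdjointEnsemble.{u})

instance isProbabilityMeasure_P (N : ℕ) : IsProbabilityMeasure (E.P N) := E.isProb N

lemma abs_eigenvalues_le (N : ℕ) (ω : E.Ω N) (k : Fin N) :
    |(E.hermitian N ω).eigenvalues k| ≤ E.opNorm N ω := by
  set v := (E.hermitian N ω).eigenvectorBasis k
  have hv : ‖v‖ = 1 := (E.hermitian N ω).eigenvectorBasis.orthonormal.1 k
  have h1 : Matrix.toEuclideanCLM (n := Fin N) (𝕜 := ℂ) (E.X N ω) v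
      = ((E.hermitian N ω).eigenvalues k : ℂ) • v := by
    ext i
    have := congrFun ((E.hermitian N ω).mulVec_eigenvectorBasis k) i
    simpa using! this
  have h2 := (Matrix.toEuclideanCLM (n := Fin N) (𝕜 := ℂ) (E.X N ω)).le_opNorm v
  rw [h1, norm_smul, hv, mul_one, mul_one, Complex.norm_real, Real.norm_eq_abs] at h2
  exact h2

lemma trFun_pow (n N : ℕ) : E.trFun (fun x => (x : ℂ) ^ n) N = E.trPow n N := by
  ext ω
  rw [trFun, trPow]
  conv_rhs => rw [(E.hermitian N ω).spectral_theorem]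
  rw [← map_pow, Unitary.conjStarAlgAut_apply, Matrix.trace_mul_cycle]
  simp [Matrix.diagonal_pow, Matrix.trace_diagonal]

lemma trFun_add (f g : ℝ → ℂ) (N : ℕ) :
    E.trFun (f + g) N = E.trFun f N + E.trFun g N := by
  ext ω
  simp [trFun, Finset.sum_add_distrib]

lemma trFun_smul (c : ℂ) (f : ℝ → ℂ) (N : ℕ) : E.trFun (c • f) N = c • E.trFun f N := by
  ext ω
  simp [trFun, Finset.mul_sum]

lemma exists_span_pow_near {f : ℝ → ℂ} (hf : Continuous f) (R : ℝ) {ε : ℝ} (hε : 0 < ε) :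
    ∃ q ∈ Submodule.span ℂ (Set.range fun (n : ℕ) (x : ℝ) => (x : ℂ) ^ n),
      ∀ x ∈ Set.Icc (-R) R, ‖f x - q x‖ < ε := by
  have htop := SegmentSpace.eq_top_of_monomial_mem
    (Submodule.span ℂ (Set.range (SegmentSpace.monomial R))).topologicalClosure
    (Submodule.isClosed_topologicalClosure _)
    (fun n => Submodule.le_topologicalClosure _ (Submodule.subset_span ⟨n, rfl⟩))
  have hmem : (⟨f, hf⟩ : C(ℝ, ℂ)).restrict (Set.Icc (-R) R) ∈ closure
      (Submodule.span ℂ (Set.range (SegmentSpace.monomial R)) : Set C(Set.Icc (-R) R, ℂ)) := by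
    rw [← Submodule.topologicalClosure_coe, htop]
    trivial
  obtain ⟨v, hv, hdist⟩ := Metric.mem_closure_iff.1 hmem ε hε
  have hlift : ∀ v ∈ Submodule.span ℂ (Set.range (SegmentSpace.monomial R)),
      ∃ q ∈ Submodule.span ℂ (Set.range fun (n : ℕ) (x : ℝ) => (x : ℂ) ^ n),
        ∀ x : Set.Icc (-R) R, q x = v x := fun v hv => by
    induction hv using Submodule.span_induction with
    | mem v hv =>
      obtain ⟨n, rfl⟩ := hv
      exact ⟨_, Submodule.subset_span ⟨n, rfl⟩, fun x => rfl⟩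
    | zero => exact ⟨0, zero_mem _, fun x => rfl⟩
    | add v w _ _ hv hw =>
      obtain ⟨p, hp, hpv⟩ := hv
      obtain ⟨q, hq, hqw⟩ := hw
      exact ⟨p + q, add_mem hp hq, fun x => by simp [hpv, hqw]⟩
    | smul c v _ hv =>
      obtain ⟨p, hp, hpv⟩ := hv
      exact ⟨c • p, Submodule.smul_mem _ _ hp, fun x => by simp [hpv]⟩
  obtain ⟨q, hq, hqv⟩ := hlift v hv
  refine ⟨q, hq, fun x hx => ?_⟩
  rw [dist_eq_norm] at hdist
  have := (ContinuousMap.norm_coe_le_norm _ ⟨x, hx⟩).trans_lt hdist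
  rwa [ContinuousMap.sub_apply, ← hqv ⟨x, hx⟩] at this

variable {E}

/-- Measurability of eigenvalues is avoided. Traces of powers are measurable by A0, hence so are
polynomial statistics. Polynomials within `1 / (n + 1)` of `f` on `[-n, n]` converge to `f` at every
eigenvalue. -/
lemma aestronglyMeasurable_trFun (h0 : E.A0) {f : ℝ → ℂ} (hf : Continuous f) (N : ℕ) :
    AEStronglyMeasurable (E.trFun f N) (E.P N) := by
  have hspan : ∀ q ∈ Submodule.span ℂ (Set.range fun (n : ℕ) (x : ℝ) => (x : ℂ) ^ n),
      AEStronglyMeasurable (E.trFun q N) (E.P N) := fun q hq => by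
    induction hq using Submodule.span_induction with
    | mem q hq =>
      obtain ⟨n, rfl⟩ := hq
      simp only [trFun_pow]
      exact (h0.memLp n N).1
    | zero => exact (aestronglyMeasurable_const (b := (0 : ℂ))).congr (.of_forall fun ω => by simp [trFun])
    | add p q _ _ hp hq =>
      rw [trFun_add]
      exact hp.add hq
    | smul c q _ hq =>
      rw [trFun_smul]
      exact hq.const_smul c
  choose q hq hqf using fun n : ℕ =>
    exists_span_pow_near hf (n : ℝ) (one_div_pos.2 (Nat.cast_add_one_pos (α := ℝ) n))
  refine aestronglyMeasurable_of_tendsto_ae atTop (fun n => hspan (q n) (hq n))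
    (.of_forall fun ω => ?_)
  refine tendsto_finsetSum _ fun k _ => ?_
  set x := (E.hermitian N ω).eigenvalues k
  refine tendsto_iff_norm_sub_tendsto_zero.2 (squeeze_zero' (.of_forall fun _ => norm_nonneg _) ?_
    tendsto_one_div_add_atTop_nhds_zero_nat)
  obtain ⟨n₀, hn₀⟩ := exists_nat_ge |x|
  filter_upwards [eventually_ge_atTop n₀] with n hn
  rw [norm_sub_rev]
  exact (hqf n x (abs_le.1 (hn₀.trans (Nat.cast_le.2 hn)))).le

/-- Even powers need no absolute value, so summing the bound over eigenvalues gives traces of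
powers, which A0 controls. -/
lemma _root_.IsSmoothTest.exists_even_bound {f : ℝ → ℂ} (hf : IsSmoothTest f) :
    ∃ C ≥ (0 : ℝ), ∃ k : ℕ, ∀ x : ℝ, ‖f x‖ ≤ C * (1 + x ^ (2 * k)) := by
  obtain ⟨-, C, k, hC⟩ := hf
  refine ⟨|C| * (2 ^ k * 2), by positivity, k, fun x => (hC x).trans ?_⟩
  have h1 : (1 + |x|) ^ k ≤ 2 ^ k * 2 * (1 + x ^ (2 * k)) := by
    have hx2 : x ^ (2 * k) = |x| ^ k * |x| ^ k := by
      rw [pow_mul, ← sq_abs, ← pow_mul, two_mul, pow_add]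
    have hp : 0 ≤ |x| ^ k := by positivity
    have h2 : (1 + |x|) ^ k ≤ 2 ^ k * (1 + |x| ^ k) := by
      rcases le_total |x| 1 with h | h
      · calc (1 + |x|) ^ k ≤ 2 ^ k := pow_le_pow_left₀ (by positivity) (by linarith) k
          _ ≤ 2 ^ k * (1 + |x| ^ k) := le_mul_of_one_le_right (by positivity) (by linarith)
      · calc (1 + |x|) ^ k ≤ (2 * |x|) ^ k := pow_le_pow_left₀ (by positivity) (by linarith) k
          _ = 2 ^ k * |x| ^ k := mul_pow _ _ _
          _ ≤ 2 ^ k * (1 + |x| ^ k) := by gcongr; linarith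
    refine h2.trans ?_
    rw [mul_assoc]
    refine mul_le_mul_of_nonneg_left ?_ (by positivity)
    rw [hx2]
    nlinarith [sq_nonneg (|x| ^ k - 1)]
  calc C * (1 + |x|) ^ k ≤ |C| * (1 + |x|) ^ k :=
        mul_le_mul_of_nonneg_right (le_abs_self C) (by positivity)
    _ ≤ |C| * (2 ^ k * 2 * (1 + x ^ (2 * k))) := by gcongr
    _ = _ := by ring

lemma trPow_zero_add_apply (k N : ℕ) (ω : E.Ω N) :
    (E.trPow 0 N + E.trPow (2 * k) N) ω
      = ((∑ j, (1 + (E.hermitian N ω).eigenvalues j ^ (2 * k)) : ℝ) : ℂ) := by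
  rw [← trFun_pow, ← trFun_pow]
  simp [trFun, Finset.sum_add_distrib]

lemma norm_trFun_le {f : ℝ → ℂ} {C : ℝ} {k : ℕ} (hC : ∀ x : ℝ, ‖f x‖ ≤ C * (1 + x ^ (2 * k)))
    (N : ℕ) (ω : E.Ω N) :
    ‖E.trFun f N ω‖ ≤ C * ∑ j, (1 + (E.hermitian N ω).eigenvalues j ^ (2 * k)) := by
  rw [Finset.mul_sum]
  exact (norm_sum_le _ _).trans (Finset.sum_le_sum fun j _ => hC _)

lemma memLp_trFun (h0 : E.A0) {f : ℝ → ℂ} (hf : IsSmoothTest f) (N : ℕ) :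
    MemLp (E.trFun f N) 2 (E.P N) := by
  obtain ⟨C, hC, k, hb⟩ := hf.exists_even_bound
  refine ((h0.memLp 0 N).add (h0.memLp (2 * k) N)).of_le_mul (c := C)
    (aestronglyMeasurable_trFun h0 hf.1.continuous N) (.of_forall fun ω => ?_)
  refine (norm_trFun_le hb N ω).trans (mul_le_mul_of_nonneg_left ?_ hC)
  rw [trPow_zero_add_apply, Complex.norm_real]
  exact le_abs_self _

/-- A linear statistic that vanishes on `[-M, M]` is asymptotically negligible. -/
lemma tendsto_integral_norm_sq_trFun (h0 : E.A0) {M : ℝ} (h1 : E.A1 M) {f : ℝ → ℂ}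
    (hf : IsSmoothTest f) (hfM : ∀ x ∈ Set.Icc (-M) M, f x = 0) :
    Tendsto (fun N : ℕ => ∫ ω, ‖E.trFun f N ω‖ ^ 2 ∂E.P N) atTop (𝓝 0) := by
  obtain ⟨C, hC, k, hb⟩ := hf.exists_even_bound
  -- The exponent `8 k` arises from the fourth power of the bound `1 + x ^ (2 * k)`.
  obtain ⟨α, hα⟩ := h0.first (2 * (4 * k))
  have hbound : ∀ N : ℕ, 1 ≤ N → ∫ ω, ‖E.trFun f N ω‖ ^ 2 ∂E.P N ≤
      (N : ℝ) ^ 5 * (E.P N).real {ω | M < E.opNorm N ω}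
        + 8 * C ^ 4 * (N : ℝ)⁻¹ * (1 + ‖(1 / (N : ℂ)) * ∫ ω, E.trPow (2 * (4 * k)) N ω ∂E.P N‖) := by
    intro N hN
    have hN0 : (0 : ℝ) < N := by exact_mod_cast hN
    -- A measurable hull of the same probability; off it all eigenvalues lie in `[-M, M]` and the
    -- statistic is zero.
    set A := toMeasurable (E.P N) {ω | M < E.opNorm N ω}
    have hA : MeasurableSet A := measurableSet_toMeasurable _ _
    set T : E.Ω N → ℝ := fun ω => ∑ j, (1 + (E.hermitian N ω).eigenvalues j ^ (2 * (4 * k)))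
    have hTeq : ∀ ω, T ω = ((E.trPow 0 N + E.trPow (2 * (4 * k)) N) ω).re := fun ω => by
      rw [trPow_zero_add_apply, Complex.ofReal_re]
    have hTC : Integrable (E.trPow 0 N + E.trPow (2 * (4 * k)) N) (E.P N) :=
      ((h0.memLp 0 N).add (h0.memLp _ N)).integrable one_le_two
    have hTi : Integrable T (E.P N) := by
      simp only [funext hTeq]
      exact hTC.re
    have hpt : ∀ ω, ‖E.trFun f N ω‖ ^ 2 ≤
        A.indicator (fun _ => (N : ℝ) ^ 5) ω + 8 * C ^ 4 * ((N : ℝ) ^ 2)⁻¹ * T ω := by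
      intro ω
      have hT0 : 0 ≤ T ω := Finset.sum_nonneg fun j _ => by
        have : 0 ≤ (E.hermitian N ω).eigenvalues j ^ (2 * (4 * k)) := by
          rw [pow_mul]; positivity
        linarith
      by_cases hω : ω ∈ A
      · rw [Set.indicator_of_mem hω]
        set S := ∑ j, (1 + (E.hermitian N ω).eigenvalues j ^ (2 * k)) with hS
        have hS0 : 0 ≤ S := Finset.sum_nonneg fun j _ => by
          have : 0 ≤ (E.hermitian N ω).eigenvalues j ^ (2 * k) := by
            rw [pow_mul]; positivity
          linarith
        have h2 : ‖E.trFun f N ω‖ ^ 2 ≤ (C * S) ^ 2 :=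
          pow_le_pow_left₀ (norm_nonneg _) (norm_trFun_le hb N ω) 2
        -- The power mean inequality over `N` eigenvalues, then `(1 + y) ^ 4 ≤ 8 (1 + y ^ 4)`.
        have h3 : S ^ 4 ≤ (N : ℝ) ^ 3 * (8 * T ω) := by
          have hnn : ∀ j, 0 ≤ (E.hermitian N ω).eigenvalues j ^ (2 * k) := fun j => by
            rw [pow_mul]; positivity
          have h4 := pow_sum_le_card_mul_sum_pow (s := Finset.univ)
            (f := fun j => 1 + (E.hermitian N ω).eigenvalues j ^ (2 * k))
            (fun j _ => by linarith [hnn j]) 3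
          rw [Finset.card_univ, Fintype.card_fin] at h4
          refine h4.trans (mul_le_mul_of_nonneg_left ?_ (by positivity))
          rw [Finset.mul_sum]
          refine Finset.sum_le_sum fun j _ => ?_
          have h5 : (E.hermitian N ω).eigenvalues j ^ (2 * (4 * k))
              = ((E.hermitian N ω).eigenvalues j ^ (2 * k)) ^ 4 := by
            rw [← pow_mul]; congr 1; ring
          rw [h5]
          set y := (E.hermitian N ω).eigenvalues j ^ (2 * k)
          have hy : 0 ≤ y := hnn j
          have h6 : 8 * (1 + y ^ 4) - (1 + y) ^ (3 + 1) = (y - 1) ^ 2 * (7 * y ^ 2 + 10 * y + 7) := by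
            ring
          have h7 : 0 ≤ (y - 1) ^ 2 * (7 * y ^ 2 + 10 * y + 7) := by positivity
          linarith
        -- A weighted form of Young's inequality. The weight `N ^ 5` leaves `N ^ 5 ℙ (A)`, small by
        -- A1, and `N ^ (-2) T`, whose mean is of order `1 / N` because the mean of `T` is of order
        -- `N`.
        have h5 : (C * S) ^ 2 ≤ (N : ℝ) ^ 5 + ((N : ℝ) ^ 5)⁻¹ * (C ^ 4 * S ^ 4) := by
          have hp : (0 : ℝ) < (N : ℝ) ^ 5 := by positivity
          have h6 : (N : ℝ) ^ 5 + ((N : ℝ) ^ 5)⁻¹ * (C ^ 4 * S ^ 4) - (C * S) ^ 2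
              = (((N : ℝ) ^ 5 - (C * S) ^ 2 / 2) ^ 2 + 3 / 4 * (C * S) ^ 4) / (N : ℝ) ^ 5 := by
            field_simp
            ring
          have h7 : 0 ≤ (((N : ℝ) ^ 5 - (C * S) ^ 2 / 2) ^ 2 + 3 / 4 * (C * S) ^ 4) / (N : ℝ) ^ 5 := by
            positivity
          linarith
        refine h2.trans (h5.trans ?_)
        have h8 : ((N : ℝ) ^ 5)⁻¹ * (C ^ 4 * S ^ 4)
            ≤ ((N : ℝ) ^ 5)⁻¹ * (C ^ 4 * ((N : ℝ) ^ 3 * (8 * T ω))) := by gcongr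
        have h9 : ((N : ℝ) ^ 5)⁻¹ * (C ^ 4 * ((N : ℝ) ^ 3 * (8 * T ω)))
            = 8 * C ^ 4 * ((N : ℝ) ^ 2)⁻¹ * T ω := by field_simp
        linarith
      · rw [Set.indicator_of_notMem hω, zero_add]
        have hle : E.opNorm N ω ≤ M := not_lt.1 fun h => hω (subset_toMeasurable _ _ h)
        have h0 : E.trFun f N ω = 0 := Finset.sum_eq_zero fun j _ =>
          hfM _ (abs_le.1 ((E.abs_eigenvalues_le N ω j).trans hle))
        rw [h0]
        have : 0 ≤ 8 * C ^ 4 * ((N : ℝ) ^ 2)⁻¹ * T ω := mul_nonneg (by positivity) hT0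
        simpa using this
    have hint := integral_mono (memLp_two_iff_integrable_sq_norm
      (memLp_trFun h0 hf N).1 |>.1 (memLp_trFun h0 hf N))
      (((integrable_const ((N : ℝ) ^ 5)).indicator hA).add
        (hTi.const_mul (8 * C ^ 4 * ((N : ℝ) ^ 2)⁻¹))) hpt
    refine hint.trans ?_
    simp only [Pi.add_apply]
    rw [integral_add ((integrable_const _).indicator hA) (hTi.const_mul _),
      integral_indicator_const _ hA, integral_const_mul]
    have hAm : (E.P N).real A = (E.P N).real {ω | M < E.opNorm N ω} := by
      simp only [measureReal_def, A, measure_toMeasurable]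
    have hTint : ∫ ω, T ω ∂E.P N ≤ N + ‖∫ ω, E.trPow (2 * (4 * k)) N ω ∂E.P N‖ := by
      have h2 : ∫ ω, T ω ∂E.P N = (∫ ω, (E.trPow 0 N + E.trPow (2 * (4 * k)) N) ω ∂E.P N).re := by
        simp only [funext hTeq]
        exact integral_re hTC
      rw [h2]
      simp only [Pi.add_apply]
      rw [integral_add ((h0.memLp 0 N).integrable one_le_two)
        ((h0.memLp _ N).integrable one_le_two), Complex.add_re]
      refine add_le_add (le_of_eq ?_) (Complex.re_le_norm _)
      simp [trPow]
    have hn : ‖(1 / (N : ℂ)) * ∫ ω, E.trPow (2 * (4 * k)) N ω ∂E.P N‖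
        = (N : ℝ)⁻¹ * ‖∫ ω, E.trPow (2 * (4 * k)) N ω ∂E.P N‖ := by
      simp
    rw [hAm, smul_eq_mul, mul_comm, hn]
    refine add_le_add le_rfl ?_
    calc 8 * C ^ 4 * ((N : ℝ) ^ 2)⁻¹ * ∫ ω, T ω ∂E.P N
        ≤ 8 * C ^ 4 * ((N : ℝ) ^ 2)⁻¹ * (N + ‖∫ ω, E.trPow (2 * (4 * k)) N ω ∂E.P N‖) := by gcongr
      _ = _ := by field_simp
  refine squeeze_zero' (.of_forall fun N => integral_nonneg fun ω => sq_nonneg _)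
    (eventually_atTop.2 ⟨1, hbound⟩) ?_
  have hA : Tendsto (fun N : ℕ => (N : ℝ) ^ 5 * (E.P N).real {ω | M < E.opNorm N ω}) atTop (𝓝 0) := by
    refine squeeze_zero' (.of_forall fun N => by positivity) ?_ h1
    filter_upwards [eventually_ge_atTop 1] with N hN
    have : (1 : ℝ) ≤ N := by exact_mod_cast hN
    gcongr
    norm_num
  have hB : Tendsto (fun N : ℕ => 8 * C ^ 4 * (N : ℝ)⁻¹ *
      (1 + ‖(1 / (N : ℂ)) * ∫ ω, E.trPow (2 * (4 * k)) N ω ∂E.P N‖)) atTop (𝓝 0) := by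
    simpa using (tendsto_inv_atTop_nhds_zero_nat (𝕜 := ℝ)).const_mul (8 * C ^ 4) |>.mul
      (hα.norm.const_add 1)
  simpa using hA.add hB

end SelfAdjointEnsemble

/-! ### Covariance and variance inequalities -/

/-- The Cauchy–Schwarz inequality for complex random variables. -/
lemma norm_integral_mul_le_sqrt {Ω : Type*} [MeasurableSpace Ω] {P : Measure Ω} {Y Z : Ω → ℂ}
    (hY : MemLp Y 2 P) (hZ : MemLp Z 2 P) :
    ‖∫ ω, Y ω * Z ω ∂P‖ ≤ √(∫ ω, ‖Y ω‖ ^ 2 ∂P) * √(∫ ω, ‖Z ω‖ ^ 2 ∂P) := by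
  have h := integral_mul_norm_le_Lp_mul_Lq (μ := P) (f := Y) (g := Z) (p := 2) (q := 2)
    Real.HolderConjugate.two_two (by simpa using hY) (by simpa using hZ)
  refine (norm_integral_le_integral_norm _).trans ?_
  simp only [norm_mul]
  simpa [Real.sqrt_eq_rpow] using h

namespace SelfAdjointEnsemble

variable {E : SelfAdjointEnsemble.{u}} {N : ℕ} {Y Z Y' Z' : E.Ω N → ℂ}

/-- The variance `𝔼 |Y - 𝔼 Y| ^ 2` as a Bochner integral. -/
noncomputable def realVariance (E : SelfAdjointEnsemble.{u}) (N : ℕ) (Y : E.Ω N → ℂ) : ℝ :=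
  ∫ ω, ‖Y ω - ∫ ω', Y ω' ∂E.P N‖ ^ 2 ∂E.P N

lemma cov_add_left (hY : MemLp Y 2 (E.P N)) (hY' : MemLp Y' 2 (E.P N)) (hZ : MemLp Z 2 (E.P N)) :
    E.cov N (Y + Y') Z = E.cov N Y Z + E.cov N Y' Z := by
  simp only [cov, Pi.add_apply, add_mul]
  have h1 : ∫ ω, (Y ω * Z ω + Y' ω * Z ω) ∂E.P N = _ :=
    integral_add (hY.integrable_mul hZ) (hY'.integrable_mul hZ)
  rw [h1,
    integral_add (hY.integrable one_le_two) (hY'.integrable one_le_two)]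
  ring

lemma cov_comm (Y Z : E.Ω N → ℂ) : E.cov N Y Z = E.cov N Z Y := by
  simp only [cov, mul_comm]

lemma cov_add_right (hY : MemLp Y 2 (E.P N)) (hZ : MemLp Z 2 (E.P N)) (hZ' : MemLp Z' 2 (E.P N)) :
    E.cov N Y (Z + Z') = E.cov N Y Z + E.cov N Y Z' := by
  rw [cov_comm, cov_add_left hZ hZ' hY, cov_comm Z, cov_comm Z']

lemma cov_smul_left (c : ℂ) (Y Z : E.Ω N → ℂ) : E.cov N (c • Y) Z = c * E.cov N Y Z := by
  simp only [cov, Pi.smul_apply, smul_eq_mul, mul_assoc, integral_const_mul]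
  ring

lemma cov_smul_right (c : ℂ) (Y Z : E.Ω N → ℂ) : E.cov N Y (c • Z) = c * E.cov N Y Z := by
  rw [cov_comm, cov_smul_left, cov_comm]

lemma cov_const_left (c : ℂ) (Z : E.Ω N → ℂ) : E.cov N (fun _ => c) Z = 0 := by
  simp [cov, integral_const_mul]

lemma cov_const_right (c : ℂ) (Y : E.Ω N → ℂ) : E.cov N Y (fun _ => c) = 0 := by
  rw [cov_comm, cov_const_left]

lemma cov_eq_integral_mul_sub (hY : MemLp Y 2 (E.P N)) (hZ : MemLp Z 2 (E.P N)) :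
    E.cov N Y Z = ∫ ω, Y ω * (Z ω - ∫ ω', Z ω' ∂E.P N) ∂E.P N := by
  simp only [mul_sub]
  have h1 : ∫ ω, (Y ω * Z ω - Y ω * ∫ ω', Z ω' ∂E.P N) ∂E.P N = _ :=
    integral_sub (hY.integrable_mul hZ) ((hY.integrable one_le_two).mul_const _)
  rw [h1, integral_mul_const, cov]

/-- Centring one factor already gives the covariance. The mixed bound pairs a statistic small in
`L²` with one whose variance A2 controls. -/
lemma norm_cov_le_of_right (hY : MemLp Y 2 (E.P N)) (hZ : MemLp Z 2 (E.P N)) :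
    ‖E.cov N Y Z‖ ≤ √(∫ ω, ‖Y ω‖ ^ 2 ∂E.P N) * √(E.realVariance N Z) := by
  rw [cov_eq_integral_mul_sub hY hZ]
  exact norm_integral_mul_le_sqrt hY (hZ.sub (memLp_const _))

lemma norm_cov_le (hY : MemLp Y 2 (E.P N)) (hZ : MemLp Z 2 (E.P N)) :
    ‖E.cov N Y Z‖ ≤ √(E.realVariance N Y) * √(E.realVariance N Z) := by
  set c := ∫ ω', Y ω' ∂E.P N with hc
  have h : E.cov N Y Z = E.cov N (Y - fun _ => c) Z := by
    have h1 := cov_add_left (hY.sub (memLp_const c)) (memLp_const c) hZ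
    rwa [sub_add_cancel, cov_const_left, add_zero] at h1
  rw [h]
  exact norm_cov_le_of_right (hY.sub (memLp_const c)) hZ

/-- Serves two remainder terms, whose derivatives may be unbounded, so that A2 says nothing about
them. -/
lemma norm_cov_le_two_mul (hY : MemLp Y 2 (E.P N)) (hZ : MemLp Z 2 (E.P N)) :
    ‖E.cov N Y Z‖ ≤ 2 * (√(∫ ω, ‖Y ω‖ ^ 2 ∂E.P N) * √(∫ ω, ‖Z ω‖ ^ 2 ∂E.P N)) := by
  have hmean : ∀ {W : E.Ω N → ℂ}, MemLp W 2 (E.P N) →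
      ‖∫ ω, W ω ∂E.P N‖ ≤ √(∫ ω, ‖W ω‖ ^ 2 ∂E.P N) := fun {W} hW => by
    simpa using norm_integral_mul_le_sqrt hW (memLp_const (1 : ℂ))
  have h1 := norm_integral_mul_le_sqrt hY hZ
  have h2 := mul_le_mul (hmean hY) (hmean hZ) (norm_nonneg _) (Real.sqrt_nonneg _)
  have h3 := norm_sub_le (∫ ω, Y ω * Z ω ∂E.P N) ((∫ ω, Y ω ∂E.P N) * ∫ ω, Z ω ∂E.P N)
  rw [norm_mul] at h3
  rw [cov]
  linarith

lemma realVariance_trFun_le {K : ℝ} (hK : 0 < K) (h0 : E.A0) (h2 : E.A2 K) {f : ℝ → ℂ}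
    (hf : IsSmoothTest f) {C : ℝ} (hC0 : 0 ≤ C) (hC : ∀ x, ‖deriv f x‖ ≤ C) (N : ℕ) :
    E.realVariance N (E.trFun f N) ≤ K * C ^ 2 := by
  have hL := (memLp_trFun h0 hf N).sub (memLp_const (∫ ω', E.trFun f N ω' ∂E.P N))
  have h0 : E.realVariance N (E.trFun f N) = _ :=
    integral_eq_lintegral_of_nonneg_ae (.of_forall fun ω => sq_nonneg _) (hL.1.norm.pow 2)
  rw [h0]
  have h1 : ∫⁻ ω, ENNReal.ofReal (‖E.trFun f N ω - ∫ ω', E.trFun f N ω' ∂E.P N‖ ^ 2) ∂E.P N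
      = E.variance N (E.trFun f N) := by
    refine lintegral_congr fun ω => ?_
    rw [ENNReal.ofReal_pow (norm_nonneg _), ofReal_norm]
  rw [h1]
  refine ENNReal.toReal_le_of_le_ofReal (by positivity) ((h2 f hf.1 N).trans ?_)
  rw [ENNReal.ofReal_mul hK.le, ENNReal.ofReal_pow hC0]
  gcongr
  refine iSup_le fun x => ?_
  rw [← ofReal_norm]
  exact ENNReal.ofReal_le_ofReal (hC x)

end SelfAdjointEnsemble

/-! ### The limiting covariance as a bounded bilinear form -/

open SegmentSpace

variable {M : ℝ}

lemma isSmoothTest_primitive (hM : 0 < M) (v : C(Set.Icc (-M) M, ℂ)) :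
    IsSmoothTest (primitive hM v) := by
  refine ⟨contDiff_primitive hM v, ‖v‖, 1, fun x => (norm_primitive_le hM v x).trans ?_⟩
  rw [pow_one]
  gcongr
  linarith

lemma IsSmoothTest.add {f g : ℝ → ℂ} (hf : IsSmoothTest f) (hg : IsSmoothTest g) :
    IsSmoothTest (f + g) := by
  obtain ⟨C, hC, k, hb⟩ := hf.exists_even_bound
  obtain ⟨C', hC', k', hb'⟩ := hg.exists_even_bound
  have hx : ∀ (l : ℕ) (x : ℝ), l ≤ k + k' → 1 + x ^ (2 * l) ≤ 2 * (1 + |x|) ^ (2 * (k + k')) := by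
    intro l x hl
    have h1 : x ^ (2 * l) ≤ (1 + |x|) ^ (2 * (k + k')) := by
      rw [pow_mul, ← sq_abs, ← pow_mul]
      exact (pow_le_pow_left₀ (abs_nonneg x) (by linarith) _).trans
        (pow_le_pow_right₀ (by linarith [abs_nonneg x]) (by omega))
    have h2 : 1 ≤ (1 + |x|) ^ (2 * (k + k')) := one_le_pow₀ (by linarith [abs_nonneg x])
    linarith
  refine ⟨hf.1.add hg.1, C * 2 + C' * 2, 2 * (k + k'), fun x => ?_⟩
  rw [add_mul, mul_assoc, mul_assoc]
  refine (norm_add_le _ _).trans (add_le_add ((hb x).trans ?_) ((hb' x).trans ?_))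
  · exact mul_le_mul_of_nonneg_left (hx k x (by omega)) hC
  · exact mul_le_mul_of_nonneg_left (hx k' x (by omega)) hC'

lemma IsSmoothTest.const_smul {f : ℝ → ℂ} (c : ℂ) (hf : IsSmoothTest f) :
    IsSmoothTest (c • f) := by
  obtain ⟨hd, C, k, hb⟩ := hf
  refine ⟨contDiff_const.smul hd, ‖c‖ * C, k, fun x => ?_⟩
  rw [Pi.smul_apply, norm_smul, mul_assoc]
  exact mul_le_mul_of_nonneg_left (hb x) (norm_nonneg c)

lemma isSmoothTest_pow (n : ℕ) : IsSmoothTest fun x : ℝ => (x : ℂ) ^ n := by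
  refine ⟨contDiff_ofReal_pow n, 1, n, fun x => ?_⟩
  rw [norm_pow, Complex.norm_real, one_mul, Real.norm_eq_abs]
  exact pow_le_pow_left₀ (abs_nonneg x) (by linarith) n

lemma isSmoothTest_const (c : ℂ) : IsSmoothTest fun _ => c :=
  ⟨contDiff_const, ‖c‖, 0, fun x => by simp⟩

/-- Uniformly bounded functionals on `C([-M, M], ℂ)` that converge on monomials converge. -/
lemma exists_tendsto_of_monomial {T : ℕ → C(Set.Icc (-M) M, ℂ) →ₗ[ℂ] ℂ} {C : ℝ}
    (hC : ∀ N v, ‖T N v‖ ≤ C * ‖v‖)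
    (h : ∀ n, ∃ a, Tendsto (fun N => T N (monomial M n)) atTop (𝓝 a)) (v : C(Set.Icc (-M) M, ℂ)) :
    ∃ a, Tendsto (fun N => T N v) atTop (𝓝 a) := by
  let S : Submodule ℂ C(Set.Icc (-M) M, ℂ) :=
    { carrier := {v | ∃ a, Tendsto (fun N => T N v) atTop (𝓝 a)}
      add_mem' := fun ⟨a, ha⟩ ⟨b, hb⟩ => ⟨a + b, by simpa using ha.add hb⟩
      zero_mem' := ⟨0, by simp⟩
      smul_mem' := fun c _ ⟨a, ha⟩ => ⟨c * a, by simpa using ha.const_mul c⟩ }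
  -- The uniform bound turns closeness to a function with convergent values into the Cauchy
  -- property; density of monomials then suffices.
  have hS : IsClosed (S : Set C(Set.Icc (-M) M, ℂ)) := by
    refine isClosed_of_closure_subset fun w hw => ?_
    refine cauchySeq_tendsto_of_complete (Metric.cauchySeq_iff.2 fun ε hε => ?_)
    have hC1 : 0 < |C| + 1 := by positivity
    obtain ⟨s, ⟨a, ha⟩, hs⟩ := Metric.mem_closure_iff.1 hw (ε / (4 * (|C| + 1))) (by positivity)
    obtain ⟨N₀, hN₀⟩ := Metric.cauchySeq_iff.1 ha.cauchySeq (ε / 2) (half_pos hε)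
    have hclose : ∀ N, dist (T N w) (T N s) ≤ ε / 4 := fun N => by
      rw [dist_eq_norm] at hs ⊢
      rw [← map_sub]
      calc ‖T N (w - s)‖ ≤ C * ‖w - s‖ := hC N _
        _ ≤ (|C| + 1) * (ε / (4 * (|C| + 1))) := by
          gcongr
          linarith [le_abs_self C]
        _ = ε / 4 := by field_simp
    refine ⟨N₀, fun m hm n hn => ?_⟩
    have h1 := hN₀ m hm n hn
    have h2 := dist_triangle4 (T m w) (T m s) (T n s) (T n w)
    have h3 := hclose n
    rw [dist_comm] at h3
    linarith [hclose m]
  have hmem : v ∈ S := eq_top_of_monomial_mem S hS h ▸ trivial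
  exact hmem

/-- Uniformly bounded bilinear forms on `C([-M, M], ℂ)` that converge on monomials converge to a
bounded bilinear form. -/
lemma exists_bilinear_limit {B : ℕ → C(Set.Icc (-M) M, ℂ) →ₗ[ℂ] C(Set.Icc (-M) M, ℂ) →ₗ[ℂ] ℂ}
    {K : ℝ} (hK : ∀ N v w, ‖B N v w‖ ≤ K * ‖v‖ * ‖w‖)
    (h : ∀ m n, ∃ a, Tendsto (fun N => B N (monomial M m) (monomial M n)) atTop (𝓝 a)) :
    ∃ B' : C(Set.Icc (-M) M, ℂ) →L[ℂ] C(Set.Icc (-M) M, ℂ) →L[ℂ] ℂ,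
      (∀ v w, Tendsto (fun N => B N v w) atTop (𝓝 (B' v w))) ∧
      ∀ v w, ‖B' v w‖ ≤ K * ‖v‖ * ‖w‖ := by
  have h1 : ∀ n v, ∃ a, Tendsto (fun N => B N v (monomial M n)) atTop (𝓝 a) := fun n =>
    exists_tendsto_of_monomial (T := fun N => (B N).flip (monomial M n)) (C := K * ‖monomial M n‖)
      (fun N v => by simpa [mul_right_comm] using hK N v (monomial M n)) (fun m => h m n)
  have h2 : ∀ v w, ∃ a, Tendsto (fun N => B N v w) atTop (𝓝 a) := fun v =>
    exists_tendsto_of_monomial (T := fun N => B N v) (C := K * ‖v‖) (fun N w => hK N v w)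
      (fun n => h1 n v)
  choose b hb using h2
  have hbound : ∀ v w, ‖b v w‖ ≤ K * ‖v‖ * ‖w‖ := fun v w =>
    le_of_tendsto (hb v w).norm (.of_forall fun N => hK N v w)
  let L : C(Set.Icc (-M) M, ℂ) →ₗ[ℂ] C(Set.Icc (-M) M, ℂ) →ₗ[ℂ] ℂ := LinearMap.mk₂ ℂ b
    (fun v v' w => tendsto_nhds_unique (hb _ _) (by simpa using (hb v w).add (hb v' w)))
    (fun c v w => tendsto_nhds_unique (hb _ _) (by simpa using (hb v w).const_mul c))
    (fun v w w' => tendsto_nhds_unique (hb _ _) (by simpa using (hb v w).add (hb v w')))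
    (fun c v w => tendsto_nhds_unique (hb _ _) (by simpa using (hb v w).const_mul c))
  exact ⟨L.mkContinuous₂ K hbound, hb, hbound⟩

namespace SelfAdjointEnsemble

variable {E : SelfAdjointEnsemble.{u}} {K : ℝ}

/-- The covariance of linear statistics as a bilinear form in the derivatives of the test
functions. -/
noncomputable def covForm (hM : 0 < M) (h0 : E.A0) (N : ℕ) :
    C(Set.Icc (-M) M, ℂ) →ₗ[ℂ] C(Set.Icc (-M) M, ℂ) →ₗ[ℂ] ℂ :=
  LinearMap.mk₂ ℂ
    (fun v w => E.cov N (E.trFun (primitive hM v) N) (E.trFun (primitive hM w) N))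
    (fun v v' w => by
      rw [primitive_add, trFun_add]
      exact cov_add_left (memLp_trFun h0 (isSmoothTest_primitive hM v) N)
        (memLp_trFun h0 (isSmoothTest_primitive hM v') N)
        (memLp_trFun h0 (isSmoothTest_primitive hM w) N))
    (fun c v w => by rw [primitive_smul, trFun_smul, cov_smul_left, smul_eq_mul])
    (fun v w w' => by
      rw [primitive_add, trFun_add]
      exact cov_add_right (memLp_trFun h0 (isSmoothTest_primitive hM v) N)
        (memLp_trFun h0 (isSmoothTest_primitive hM w) N)
        (memLp_trFun h0 (isSmoothTest_primitive hM w') N))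
    (fun c v w => by rw [primitive_smul, trFun_smul, cov_smul_right, smul_eq_mul])

lemma sqrt_realVariance_primitive_le (hM : 0 < M) (hK : 0 < K) (h0 : E.A0) (h2 : E.A2 K)
    (v : C(Set.Icc (-M) M, ℂ)) (N : ℕ) :
    √(E.realVariance N (E.trFun (primitive hM v) N)) ≤ √K * ‖v‖ := by
  rw [← Real.sqrt_sq (norm_nonneg v), ← Real.sqrt_mul hK.le]
  refine Real.sqrt_le_sqrt
    (realVariance_trFun_le hK h0 h2 (isSmoothTest_primitive hM v) (norm_nonneg v) (fun x => ?_) N)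
  rw [deriv_primitive]
  exact norm_IccExtend_le hM v x

lemma norm_covForm_le (hM : 0 < M) (hK : 0 < K) (h0 : E.A0) (h2 : E.A2 K) (N : ℕ)
    (v w : C(Set.Icc (-M) M, ℂ)) : ‖covForm hM h0 N v w‖ ≤ K * ‖v‖ * ‖w‖ := by
  refine (norm_cov_le (memLp_trFun h0 (isSmoothTest_primitive hM v) N)
    (memLp_trFun h0 (isSmoothTest_primitive hM w) N)).trans ?_
  calc _ ≤ (√K * ‖v‖) * (√K * ‖w‖) :=
        mul_le_mul (sqrt_realVariance_primitive_le hM hK h0 h2 v N)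
          (sqrt_realVariance_primitive_le hM hK h0 h2 w N) (Real.sqrt_nonneg _) (by positivity)
    _ = (√K * √K) * ‖v‖ * ‖w‖ := by ring
    _ = K * ‖v‖ * ‖w‖ := by rw [Real.mul_self_sqrt hK.le]

/-- Up to a constant and a negligible term, a linear statistic depends only on the derivative of
the test function on `[-M, M]`. -/
lemma exists_trFun_eq_primitive_add (hM : 0 < M) (h0 : E.A0) (h1 : E.A1 M) {f : ℝ → ℂ}
    (hf : IsSmoothTest f) :
    ∃ g : ℝ → ℂ, IsSmoothTest g ∧
      Tendsto (fun N : ℕ => √(∫ ω, ‖E.trFun g N ω‖ ^ 2 ∂E.P N)) atTop (𝓝 0) ∧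
      ∀ N, E.trFun f N
        = E.trFun (primitive hM (derivOn M f hf.1)) N + E.trFun g N + fun _ => N * f 0 := by
  set p := primitive hM (derivOn M f hf.1)
  have hp : IsSmoothTest p := isSmoothTest_primitive hM _
  -- The remainder `f - p - f 0` vanishes on `[-M, M]` by the fundamental theorem of calculus.
  have hg : IsSmoothTest (f + ((-1 : ℂ) • p + fun _ => -f 0)) :=
    hf.add ((hp.const_smul _).add (isSmoothTest_const _))
  refine ⟨_, hg, ?_, fun N => ?_⟩
  · have h := tendsto_integral_norm_sq_trFun h0 h1 hg fun x hx => by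
      have := eqOn_primitive_derivOn hM f hf.1 hx
      simp only [Pi.add_apply, Pi.smul_apply, this, p]
      simp
    simpa using h.sqrt
  · ext ω
    simp [trFun, Finset.sum_add_distrib]
    ring

lemma tendsto_cov_sub_covForm (hM : 0 < M) (hK : 0 < K) (h0 : E.A0) (h1 : E.A1 M) (h2 : E.A2 K)
    {f g : ℝ → ℂ} (hf : IsSmoothTest f) (hg : IsSmoothTest g) :
    Tendsto (fun N : ℕ => E.cov N (E.trFun f N) (E.trFun g N)
      - covForm hM h0 N (derivOn M f hf.1) (derivOn M g hg.1)) atTop (𝓝 0) := by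
  obtain ⟨r, hr, hr0, hfr⟩ := exists_trFun_eq_primitive_add hM h0 h1 hf
  obtain ⟨s, hs, hs0, hgs⟩ := exists_trFun_eq_primitive_add hM h0 h1 hg
  set v := derivOn M f hf.1
  set w := derivOn M g hg.1
  have hb : ∀ N : ℕ, ‖E.cov N (E.trFun f N) (E.trFun g N) - covForm hM h0 N v w‖ ≤
      √(∫ ω, ‖E.trFun s N ω‖ ^ 2 ∂E.P N) * (√K * ‖v‖)
      + √(∫ ω, ‖E.trFun r N ω‖ ^ 2 ∂E.P N) * (√K * ‖w‖)
      + 2 * (√(∫ ω, ‖E.trFun r N ω‖ ^ 2 ∂E.P N) * √(∫ ω, ‖E.trFun s N ω‖ ^ 2 ∂E.P N)) := by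
    intro N
    have hP := memLp_trFun h0 (isSmoothTest_primitive hM v) N
    have hQ := memLp_trFun h0 (isSmoothTest_primitive hM w) N
    have hR := memLp_trFun h0 hr N
    have hS := memLp_trFun h0 hs N
    -- Bilinear expansion: constants drop out, the two primitives cancel `covForm`, and every
    -- surviving term contains a remainder.
    have heq : E.cov N (E.trFun f N) (E.trFun g N) - covForm hM h0 N v w
        = E.cov N (E.trFun s N) (E.trFun (primitive hM v) N)
          + E.cov N (E.trFun r N) (E.trFun (primitive hM w) N)
          + E.cov N (E.trFun r N) (E.trFun s N) := by
      rw [hfr N, hgs N, cov_add_left (hP.add hR) (memLp_const _) ((hQ.add hS).add (memLp_const _)),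
        cov_const_left, cov_add_right (hP.add hR) (hQ.add hS) (memLp_const _), cov_const_right,
        cov_add_left hP hR (hQ.add hS), cov_add_right hP hQ hS, cov_add_right hR hQ hS,
        cov_comm (E.trFun s N)]
      simp only [covForm, LinearMap.mk₂_apply]
      ring
    rw [heq]
    refine (norm_add₃_le).trans (add_le_add (add_le_add ?_ ?_) (norm_cov_le_two_mul hR hS))
    · exact (norm_cov_le_of_right hS hP).trans (mul_le_mul_of_nonneg_left
        (sqrt_realVariance_primitive_le hM hK h0 h2 v N) (Real.sqrt_nonneg _))
    · exact (norm_cov_le_of_right hR hQ).trans (mul_le_mul_of_nonneg_left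
        (sqrt_realVariance_primitive_le hM hK h0 h2 w N) (Real.sqrt_nonneg _))
  refine squeeze_zero_norm hb ?_
  simpa using ((hs0.mul_const (√K * ‖v‖)).add (hr0.mul_const (√K * ‖w‖))).add
    ((hr0.mul hs0).const_mul 2)

lemma A0.tendsto_secondMoment (h0 : E.A0) (m n : ℕ) :
    Tendsto (fun N => E.cov N (E.trPow m N) (E.trPow n N)) atTop (𝓝 (E.secondMoment m n)) :=
  tendsto_nhds_limUnder (h0.second m n)

/-- The limiting covariance as a bounded bilinear form in the derivatives of the test functions. -/
lemma exists_limit_covForm (hM : 0 < M) (hK : 0 < K) (h0 : E.A0) (h1 : E.A1 M) (h2 : E.A2 K) :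
    ∃ B : C(Set.Icc (-M) M, ℂ) →L[ℂ] C(Set.Icc (-M) M, ℂ) →L[ℂ] ℂ,
      (∀ v w, ‖B v w‖ ≤ K * ‖v‖ * ‖w‖) ∧
      ∀ (f g : ℝ → ℂ) (hf : IsSmoothTest f) (hg : IsSmoothTest g),
        Tendsto (fun N : ℕ => E.cov N (E.trFun f N) (E.trFun g N)) atTop
          (𝓝 (B (derivOn M f hf.1) (derivOn M g hg.1))) := by
  obtain ⟨B, hB, hBK⟩ := exists_bilinear_limit (B := fun N => covForm hM h0 N)
    (norm_covForm_le hM hK h0 h2) fun m n => by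
      -- The monomial `x ^ m` is a derivative of `x ^ (m + 1) / (m + 1)`, hence the shifted moments
      -- and the division below.
      have h3 := (h0.tendsto_secondMoment (m + 1) (n + 1)).sub
        (tendsto_cov_sub_covForm hM hK h0 h1 h2 (isSmoothTest_pow (m + 1)) (isSmoothTest_pow (n + 1)))
      simp only [trFun_pow, sub_sub_cancel, derivOn_pow, map_smul, LinearMap.smul_apply,
        smul_eq_mul] at h3
      have hm : (m : ℂ) + 1 ≠ 0 := Nat.cast_add_one_ne_zero m
      have hn : (n : ℂ) + 1 ≠ 0 := Nat.cast_add_one_ne_zero n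
      refine ⟨_, (h3.const_mul (((m : ℂ) + 1) * ((n : ℂ) + 1))⁻¹).congr fun N => ?_⟩
      field_simp
  refine ⟨B, hBK, fun f g hf hg => ?_⟩
  simpa using (tendsto_cov_sub_covForm hM hK h0 h1 h2 hf hg).add
    (hB (derivOn M f hf.1) (derivOn M g hg.1))

end SelfAdjointEnsemble

/-! ### Differentiation on `C¹([-M, M])` and vector-valued Cauchy integrals -/

namespace SegmentSpace

/-- A `C¹` extension to `ℝ` of an element of `C¹([-M, M])`. -/
noncomputable def extension (h : C1On M) : ℝ → ℂ := Exists.choose (show ∃ f : ℝ → ℂ,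
  ContDiff ℝ 1 f ∧ ∀ x, h.1 x = f x from h.2)

lemma contDiff_extension (h : C1On M) : ContDiff ℝ 1 (extension h) :=
  (Exists.choose_spec (show ∃ f : ℝ → ℂ, ContDiff ℝ 1 f ∧ ∀ x, h.1 x = f x from h.2)).1

lemma extension_apply (h : C1On M) {x : ℝ} (hx : x ∈ Set.Icc (-M) M) :
    extension h x = h.1 ⟨x, hx⟩ :=
  ((Exists.choose_spec (show ∃ f : ℝ → ℂ, ContDiff ℝ 1 f ∧ ∀ x, h.1 x = f x from h.2)).2
    ⟨x, hx⟩).symm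

/-- Differentiation as a linear map from `C¹([-M, M])` to `C([-M, M], ℂ)`. -/
noncomputable def derivMap (hM : 0 < M) : C1On M →ₗ[ℂ] C(Set.Icc (-M) M, ℂ) where
  toFun h := derivOn M (extension h) (contDiff_extension h)
  map_add' a b := by
    -- The chosen extensions need not be additive, but on the segment they are, and that determines
    -- the derivative there.
    have h : Set.EqOn (extension (a + b)) (extension a + extension b) (Set.Icc (-M) M) :=
      fun x hx => by
        rw [Pi.add_apply, extension_apply _ hx, extension_apply _ hx, extension_apply _ hx]
        rfl
    rw [derivOn_congr hM _ ((contDiff_extension a).add (contDiff_extension b)) h]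
    ext x
    exact deriv_add ((contDiff_extension a).differentiable one_ne_zero _)
      ((contDiff_extension b).differentiable one_ne_zero _)
  map_smul' c a := by
    have h : Set.EqOn (extension (c • a)) (c • extension a) (Set.Icc (-M) M) := fun x hx => by
      rw [Pi.smul_apply, extension_apply _ hx, extension_apply _ hx]
      rfl
    rw [derivOn_congr hM _ (contDiff_const.smul (contDiff_extension a)) h]
    ext x
    exact deriv_const_smul c ((contDiff_extension a).differentiable one_ne_zero _)

lemma derivMap_restrictC1 (hM : 0 < M) (f : ℝ → ℂ) (hf : ContDiff ℝ 1 f) :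
    derivMap hM (restrictC1 M f hf) = derivOn M f hf :=
  derivOn_congr hM (contDiff_extension _) hf fun _ hx => extension_apply _ hx

/-- The primitive as a linear map from `C([-M, M], ℂ)` to `C¹([-M, M])`. -/
noncomputable def primitiveMap (hM : 0 < M) : C(Set.Icc (-M) M, ℂ) →ₗ[ℂ] C1On M where
  toFun v := restrictC1 M (primitive hM v) (contDiff_primitive hM v)
  map_add' v w := Subtype.ext <| funext fun x => congrFun (primitive_add hM v w) x
  map_smul' c v := Subtype.ext <| funext fun x => congrFun (primitive_smul hM c v) x

lemma restrictC1_eq_add_primitiveMap (hM : 0 < M) (f : ℝ → ℂ) (hf : ContDiff ℝ 1 f) :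
    restrictC1 M f hf
      = restrictC1 M (fun _ => f 0) contDiff_const + primitiveMap hM (derivOn M f hf) :=
  Subtype.ext <| funext fun x => eqOn_primitive_derivOn hM f hf x.2

/-- Evaluation of a functional on a vector-valued contour integral. -/
lemma contourIntegral_mul_clm {γ : ℝ → ℂ} (hγ : IsSimpleClosedContour γ)
    {φ : ℂ → C(Set.Icc (-M) M, ℂ)} (hφ : ContinuousOn φ (contourImage γ)) {F : ℂ → ℂ}
    (hF : ContinuousOn F (contourImage γ)) (L : C(Set.Icc (-M) M, ℂ) →L[ℂ] ℂ) :
    contourIntegral γ (fun z => F z * L (φ z))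
      = L (∫ t in (0 : ℝ)..1, (F (γ t) * deriv γ t) • φ (γ t)) := by
  have hint : IntervalIntegrable (fun t => (F (γ t) * deriv γ t) • φ (γ t)) volume 0 1 :=
    (hγ.intervalIntegrable hF).smul_continuousOn (hγ.continuousOn_comp hφ)
  rw [← L.intervalIntegral_comp_comm hint]
  refine intervalIntegral.integral_congr fun t _ => ?_
  simp only [map_smul, smul_eq_mul]
  ring

/-- The Cauchy formula for the derivative, uniformly on `[-M, M]`. -/
lemma contourIntegral_smul_resolventSq (hM : 0 < M) {γ : ℝ → ℂ} (hγ : IsSimpleClosedContour γ)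
    (hpos : IsPositivelyOriented γ) {U : Set ℂ} (hU : IsOpen U)
    (hγU : contourImage γ ⊆ U) (hint : contourInterior γ ⊆ U)
    (hseg : realSegment M ⊆ contourInterior γ) {f : ℝ → ℂ} (hf : ContDiff ℝ 1 f) {F : ℂ → ℂ}
    (hF : IsAnalyticExtension M f U F) :
    ∫ t in (0 : ℝ)..1, (F (γ t) * deriv γ t) • resolventSq M (γ t)
      = (2 * (Real.pi : ℂ) * Complex.I) • derivOn M f hf := by
  have hout : ∀ z ∈ contourImage γ, z ∉ realSegment M := fun z hz h => (hseg h).1 hz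
  have hφ : ContinuousOn (resolventSq M) (contourImage γ) := fun z hz =>
    (analyticAt_resolventSq (hout z hz)).continuousAt.continuousWithinAt
  have hFc : ContinuousOn F (contourImage γ) := hF.1.continuousOn.mono hγU
  ext x
  have h1 := contourIntegral_mul_clm hγ hφ hFc (ContinuousMap.evalCLM ℂ x)
  have h2 : contourIntegral γ (fun z => F z * ContinuousMap.evalCLM ℂ x (resolventSq M z))
      = contourIntegral γ (fun z => F z * ((z - ((x : ℝ) : ℂ)) ^ 2)⁻¹) :=
    IsSimpleClosedContour.contourIntegral_congr fun z hz => by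
      simp [resolventSq_apply (hout z hz)]
  have hxint : ((x : ℝ) : ℂ) ∈ contourInterior γ := hseg ⟨x, x.2, rfl⟩
  rw [h2, hγ.contourIntegral_mul_inv_sub_sq hpos hU hγU hint hF.1.differentiableOn hxint] at h1
  -- The complex derivative of `F` restricts to the real one of `f`, since both functions agree on
  -- the segment.
  have h3 : deriv F ((x : ℝ) : ℂ) = deriv f x :=
    deriv_eq_of_eqOn hM ((hF.1 _ (hint hxint)).differentiableAt.hasDerivAt.comp_ofReal)
      (hf.differentiable one_ne_zero _).hasDerivAt hF.2 x.2
  rw [h3] at h1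
  exact h1.symm

end SegmentSpace

/-! ### Covariance extensions and the second-order Cauchy transform -/

namespace SelfAdjointEnsemble

variable {E : SelfAdjointEnsemble.{u}} {K : ℝ}
  {B : C(Set.Icc (-M) M, ℂ) →L[ℂ] C(Set.Icc (-M) M, ℂ) →L[ℂ] ℂ}

/-- `B` represents the second-order moments in terms of derivatives. -/
def RepresentsMoments (E : SelfAdjointEnsemble.{u})
    (B : C(Set.Icc (-M) M, ℂ) →L[ℂ] C(Set.Icc (-M) M, ℂ) →L[ℂ] ℂ) : Prop :=
  ∀ (m n : ℕ) (hm : ContDiff ℝ 1 fun x : ℝ => (x : ℂ) ^ m)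
    (hn : ContDiff ℝ 1 fun x : ℝ => (x : ℂ) ^ n),
    B (derivOn M _ hm) (derivOn M _ hn) = E.secondMoment m n

lemma RepresentsMoments.apply_monomial (hB : E.RepresentsMoments B) (m n : ℕ) :
    ((m : ℂ) + 1) * (((n : ℂ) + 1) * B (monomial M m) (monomial M n))
      = E.secondMoment (m + 1) (n + 1) := by
  rw [← hB (m + 1) (n + 1) (contDiff_ofReal_pow _) (contDiff_ofReal_pow _)]
  simp only [derivOn_pow, map_smul, smul_apply, smul_eq_mul]
  ring

lemma RepresentsMoments.isCovarianceExtension (hM : 0 < M) (hB : E.RepresentsMoments B)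
    (hBK : ∀ v w, ‖B v w‖ ≤ K * ‖v‖ * ‖w‖) :
    ∃ ρ : C1On M →ₗ[ℂ] C1On M →ₗ[ℂ] ℂ, IsCovarianceExtension E M K ρ := by
  refine ⟨LinearMap.mk₂ ℂ (fun a b => B (derivMap hM a) (derivMap hM b))
    (by simp) (by simp) (by simp) (by simp), fun m n hm hn => ?_, fun f g hf hg => ?_⟩
  · rw [LinearMap.mk₂_apply, derivMap_restrictC1, derivMap_restrictC1]
    exact hB m n hm hn
  · rw [LinearMap.mk₂_apply, derivMap_restrictC1, derivMap_restrictC1, ← norm_derivOn M f hf,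
      ← norm_derivOn M g hg]
    exact hBK _ _

/-- Every covariance extension is given by `B` applied to derivatives. -/
lemma RepresentsMoments.eq_of_isCovarianceExtension (hM : 0 < M) (hB : E.RepresentsMoments B)
    {ρ : C1On M →ₗ[ℂ] C1On M →ₗ[ℂ] ℂ} (hρ : IsCovarianceExtension E M K ρ) (f g : ℝ → ℂ)
    (hf : ContDiff ℝ 1 f) (hg : ContDiff ℝ 1 g) :
    ρ (restrictC1 M f hf) (restrictC1 M g hg) = B (derivOn M f hf) (derivOn M g hg) := by
  have hbound : ∀ (f g : ℝ → ℂ) (hf : ContDiff ℝ 1 f) (hg : ContDiff ℝ 1 g),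
      ‖ρ (restrictC1 M f hf) (restrictC1 M g hg)‖ ≤ K * ‖derivOn M f hf‖ * ‖derivOn M g hg‖ := by
    intro f g hf hg
    rw [norm_derivOn, norm_derivOn]
    exact hρ.bound f g hf hg
  -- A constant has zero derivative, so the bound annihilates it in either slot and `ρ` depends only
  -- on derivatives.
  have hl : ∀ (c : ℂ) (g : ℝ → ℂ) (hg : ContDiff ℝ 1 g),
      ρ (restrictC1 M (fun _ => c) contDiff_const) (restrictC1 M g hg) = 0 := fun c g hg => by
    simpa [derivOn_const] using hbound _ g contDiff_const hg
  have hr : ∀ (c : ℂ) (f : ℝ → ℂ) (hf : ContDiff ℝ 1 f),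
      ρ (restrictC1 M f hf) (restrictC1 M (fun _ => c) contDiff_const) = 0 := fun c f hf => by
    simpa [derivOn_const] using hbound f _ hf contDiff_const
  let B' : C(Set.Icc (-M) M, ℂ) →L[ℂ] C(Set.Icc (-M) M, ℂ) →L[ℂ] ℂ :=
    LinearMap.mkContinuous₂ (ρ.compl₁₂ (primitiveMap hM) (primitiveMap hM)) K fun v w => by
      have := hbound _ _ (contDiff_primitive hM v) (contDiff_primitive hM w)
      rwa [derivOn_primitive, derivOn_primitive] at this
  have hB' : ∀ (f g : ℝ → ℂ) (hf : ContDiff ℝ 1 f) (hg : ContDiff ℝ 1 g),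
      ρ (restrictC1 M f hf) (restrictC1 M g hg) = B' (derivOn M f hf) (derivOn M g hg) := by
    intro f g hf hg
    rw [restrictC1_eq_add_primitiveMap hM f hf, map_add, LinearMap.add_apply, hl, zero_add,
      restrictC1_eq_add_primitiveMap hM g hg, map_add]
    have h0 : ρ (primitiveMap hM (derivOn M f hf))
      (restrictC1 M (fun _ => g 0) contDiff_const) = 0 := hr (g 0) _ (contDiff_primitive hM _)
    rw [h0, zero_add]
    rfl
  have hrep : E.RepresentsMoments B' := fun m n hm hn => by
    rw [← hB', hρ.moments]
  have : B' = B := bilinear_ext fun m n => by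
    have h := (hrep.apply_monomial m n).trans (hB.apply_monomial m n).symm
    exact mul_left_cancel₀ (Nat.cast_add_one_ne_zero n)
      (mul_left_cancel₀ (Nat.cast_add_one_ne_zero m) h)
  rw [hB', this]

/-- Expanding both resolvents, the factors `(m + 1)(n + 1)` turn `B (x ^ m, x ^ n)` into the moment
with indices `m + 1` and `n + 1`. -/
lemma RepresentsMoments.isSecondOrderCauchyTransform (hM : 0 < M) (hB : E.RepresentsMoments B) :
    IsSecondOrderCauchyTransform E M fun p => B (resolventSq M p.1) (resolventSq M p.2) := by
  constructor
  · rintro ⟨z, w⟩ ⟨hz, hw⟩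
    have h1 : AnalyticAt ℂ (fun p : ℂ × ℂ => resolventSq M p.1) (z, w) :=
      AnalyticAt.comp (g := resolventSq M) (f := Prod.fst) (analyticAt_resolventSq hz) analyticAt_fst
    have h2 : AnalyticAt ℂ (fun p : ℂ × ℂ => resolventSq M p.2) (z, w) :=
      AnalyticAt.comp (g := resolventSq M) (f := Prod.snd) (analyticAt_resolventSq hw) analyticAt_snd
    have h3 := B.analyticAt_bilinear (resolventSq M z, resolventSq M w)
    exact AnalyticAt.comp₂ (h := fun q : C(Set.Icc (-M) M, ℂ) × C(Set.Icc (-M) M, ℂ) => B q.1 q.2)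
      (f := fun p : ℂ × ℂ => resolventSq M p.1) (g := fun p : ℂ × ℂ => resolventSq M p.2) h3 h1 h2
  · intro z w hz hw
    convert! hasSum_bilinear B (hasSum_resolventSq hM hz) (hasSum_resolventSq hM hw)
      (summable_norm_resolventSq hM hz) (summable_norm_resolventSq hM hw) using 1
    ext ⟨m, n⟩
    simp only [map_smul, smul_apply, smul_eq_mul, ← hB.apply_monomial]
    ring

end SelfAdjointEnsemble

open SelfAdjointEnsemble

/-- The second-order Cauchy transform is unique. -/
lemma IsSecondOrderCauchyTransform.eqOn {E : SelfAdjointEnsemble.{u}} (hM : 0 < M)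
    {G G' : ℂ × ℂ → ℂ} (hG : IsSecondOrderCauchyTransform E M G)
    (hG' : IsSecondOrderCauchyTransform E M G') :
    Set.EqOn G G' ((realSegment M)ᶜ ×ˢ (realSegment M)ᶜ) := by
  have hx : M < ‖((M + 1 : ℝ) : ℂ)‖ := by
    rw [Complex.norm_real, Real.norm_eq_abs, abs_of_pos (by linarith)]
    linarith
  refine hG.analytic.eqOn_of_preconnected_of_eventuallyEq hG'.analytic
    ((isPreconnected_compl_realSegment hM).prod (isPreconnected_compl_realSegment hM))
    (z₀ := (((M + 1 : ℝ) : ℂ), ((M + 1 : ℝ) : ℂ)))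
    ⟨notMem_realSegment_of_lt_norm hx, notMem_realSegment_of_lt_norm hx⟩ ?_
  have hopen : IsOpen {p : ℂ × ℂ | M < ‖p.1‖ ∧ M < ‖p.2‖} :=
    (isOpen_lt continuous_const continuous_fst.norm).inter
      (isOpen_lt continuous_const continuous_snd.norm)
  filter_upwards [hopen.mem_nhds ⟨hx, hx⟩] with p hp
  exact (hG.series p.1 p.2 hp.1 hp.2).unique (hG'.series p.1 p.2 hp.1 hp.2)

theorem theorem3p5 (E : SelfAdjointEnsemble.{u}) (M K : ℝ) (hM : 0 < M) (hK : 0 < K)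
    (h0 : E.A0) (h1 : E.A1 M) (h2 : E.A2 K) :
    (∃! ρ : C1On M →ₗ[ℂ] C1On M →ₗ[ℂ] ℂ, IsCovarianceExtension E M K ρ) ∧
    (∃ G : ℂ × ℂ → ℂ, IsSecondOrderCauchyTransform E M G) ∧
    ∀ ρ : C1On M →ₗ[ℂ] C1On M →ₗ[ℂ] ℂ, IsCovarianceExtension E M K ρ →
    ∀ (f g : ℝ → ℂ) (hf : IsSmoothTest f) (hg : IsSmoothTest g),
      Tendsto (fun N : ℕ => E.cov N (E.trFun f N) (E.trFun g N)) atTop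
        (𝓝 (ρ (restrictC1 M f hf.1) (restrictC1 M g hg.1))) ∧
      ∀ G : ℂ × ℂ → ℂ, IsSecondOrderCauchyTransform E M G →
      ∀ U : Set ℂ, IsOpen U → IsConnected U → realSegment M ⊆ U →
      ∀ F H : ℂ → ℂ, IsAnalyticExtension M f U F → IsAnalyticExtension M g U H →
      ∀ γ : ℝ → ℂ, IsSimpleClosedContour γ → IsPositivelyOriented γ →
        contourImage γ ⊆ U → contourInterior γ ⊆ U → realSegment M ⊆ contourInterior γ →
        ρ (restrictC1 M f hf.1) (restrictC1 M g hg.1) =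
          1 / (2 * (Real.pi : ℂ) * Complex.I) ^ 2 *
            contourIntegral γ (fun w => contourIntegral γ (fun z => F z * H w * G (z, w))) := by
  obtain ⟨B, hBK, hBlim⟩ := exists_limit_covForm hM hK h0 h1 h2
  have hB : E.RepresentsMoments B := fun m n hm hn => by
    have h := hBlim _ _ (isSmoothTest_pow m) (isSmoothTest_pow n)
    simp only [trFun_pow] at h
    exact tendsto_nhds_unique h (h0.tendsto_secondMoment m n)
  refine ⟨?_, ⟨_, hB.isSecondOrderCauchyTransform hM⟩, fun ρ hρ f g hf hg => ⟨?_, ?_⟩⟩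
  · obtain ⟨ρ, hρ⟩ := hB.isCovarianceExtension hM hBK
    refine ⟨ρ, hρ, fun ρ' hρ' => LinearMap.ext₂ ?_⟩
    rintro ⟨a, f, hf, hfa⟩ ⟨b, g, hg, hgb⟩
    obtain rfl : a = fun x : Set.Icc (-M) M => f x := funext hfa
    obtain rfl : b = fun x : Set.Icc (-M) M => g x := funext hgb
    exact (hB.eq_of_isCovarianceExtension hM hρ' f g hf hg).trans
      (hB.eq_of_isCovarianceExtension hM hρ f g hf hg).symm
  · rw [hB.eq_of_isCovarianceExtension hM hρ]
    exact hBlim f g hf hg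
  · intro G hG U hU _ _ F H hF hH γ hγ hpos hγU hint hseg
    rw [hB.eq_of_isCovarianceExtension hM hρ]
    have hout : ∀ z ∈ contourImage γ, z ∉ realSegment M := fun z hz h => (hseg h).1 hz
    have hφ : ContinuousOn (resolventSq M) (contourImage γ) := fun z hz =>
      (analyticAt_resolventSq (hout z hz)).continuousAt.continuousWithinAt
    -- By uniqueness `G` is `B` of two resolvents on the contour. For fixed `w` the integral in `z`
    -- moves inside the first slot of `B`, where Cauchy's formula replaces it by `2πi f'`; the
    -- integral in `w` then does the same in the second slot.
    have hinner : ∀ w ∈ contourImage γ,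
        contourIntegral γ (fun z => F z * H w * G (z, w)) = H w *
          B ((2 * (Real.pi : ℂ) * Complex.I) • derivOn M f hf.1) (resolventSq M w) := by
      intro w hw
      rw [← contourIntegral_smul_resolventSq hM hγ hpos hU hγU hint hseg hf.1 hF,
        ← ContinuousLinearMap.flip_apply,
        ← contourIntegral_mul_clm hγ hφ (hF.1.continuousOn.mono hγU),
        ← IsSimpleClosedContour.contourIntegral_const_mul]
      refine IsSimpleClosedContour.contourIntegral_congr fun z hz => ?_
      rw [hG.eqOn hM (hB.isSecondOrderCauchyTransform hM)
        (show (z, w) ∈ _ from ⟨hout z hz, hout w hw⟩), ContinuousLinearMap.flip_apply]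
      ring
    rw [IsSimpleClosedContour.contourIntegral_congr hinner,
      contourIntegral_mul_clm hγ hφ (hH.1.continuousOn.mono hγU),
      contourIntegral_smul_resolventSq hM hγ hpos hU hγU hint hseg hg.1 hH]
    simp only [map_smul, smul_apply, smul_eq_mul]
    have hpi := Complex.two_pi_I_ne_zero
    field_simp
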